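/- **Setting.** Let $\mathbb{C}$ be a finitely complete and finitely cocomplete category with a symmetric monoidal product $\otimes$ whose unit $1$ is terminal (i.e. $\otimes$ is affine) and such that each $X\otimes-$ preserves finite colimits. Let $\delta_0,\delta_1\colon 1\to\mathbb{I}$ be an interval object (an object with two points), and let $P$ be a right adjoint of $-\otimes\mathbb{I}$; write $e_i\colon PX\to X$ for evaluation at $\delta_i$. Let $\xi\colon(C^t,F)\to(C,F^t)$ be a pre algebraic model structure on $\mathbb{C}$, i.e. two algebraic weak factorisation systems and a morphism between them. A (structured) *fibration*, respectively *trivial fibration*, is an algebra over the monad $F$, respectively $F^t$; a (structured) *cofibration*, respectively *trivial cofibration*, is a coalgebra over the copointed endofunctor underlying $C$, respectively $C^t$. Suppose that $(C,F^t)$ is *pullback stable*: if a square $f\to g$ in $\mathbb{C}$ is a pullback, then so is the induced square $F^t f\to F^t g$. Suppose also that: 1. to each cofibration structure on $m$ is functorially assigned a cofibration structure on the pushout product $m\mathbin{\hat\otimes}[\delta_0,\delta_1]$, where $[\delta_0,\delta_1]\colon 1+1\to\mathbb{I}$; 2. for $i=0,1$, to each fibration structure on $f\colon X\to Y$ is functorially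 assigned a trivial fibration structure on the pullback hom $\widehat{\hom}(\delta_i,f)\colon PX\to X\times_Y PY$; 3. to each fibration structure on $f\colon X\to Y$ is functorially assigned a fibration structure on the pullback hom $\widehat{\hom}([\delta_0,\delta_1],f)\colon PX\to (X\times X)\times_{Y\times Y}PY$. For $f\colon X\to Y$ let $P_Y(X)$ be the mapping path space, the pullback of $Pf\colon PX\to PY$ along the map $Y\to PY$ corresponding to the projection $Y\otimes\mathbb{I}\to Y$. Let $r\colon X\to P_Y(X)$ be the reflexivity map, given by the constant paths, and $p_f=\langle p_0,p_1\rangle\colon P_Y(X)\to X\times_Y X$ the endpoint map, where $p_i$ is the composite of $P_Y(X)\to PX$ with $e_i$. Factor $r$ using $(C,F^t)$ as $$X\xrightarrow{\;C r\;}\operatorname{Id}_Y(X)\xrightarrow{\;F^t r\;}P_Y(X).$$ **Theorem.** The factorisations $$X\xrightarrow{\;C r\;}\operatorname{Id}_Y(X)\xrightarrow{\;p_f\circ F^t r\;}X\times_Y X$$ of the diagonals, for fibrations $f\colon X\to Y$, can be given the structure of a stable functorial choice of very good path objects. That is, every fibration $f$ is assigned a trivial cofibration structure on $C r$ and a fibration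 structure on $p_f\circ F^t r$; for every morphism of fibrations from $f\colon X\to Y$ to $f'\colon X'\to Y'$ the induced squares from $C r$ to $C r'$ and from $p_f\circ F^t r$ to $p_{f'}\circ F^t r'$ (where $r'\colon X'\to P_{Y'}(X')$ is the reflexivity map of $f'$) preserve these structures; and whenever the underlying square $f\to f'$ is a pullback, the square $$\begin{array}{ccc}\operatorname{Id}_Y(X)&\to&\operatorname{Id}_{Y'}(X')\\ \downarrow&&\downarrow\\ X\times_Y X&\to&X'\times_{Y'}X'\end{array}$$ is a pullback. Moreover, $C r$ is, functorially in the fibration $f$, a structured strong deformation retract: there are maps $i\colon\operatorname{Id}_Y(X)\to X$ with $i\circ C r=1_X$ and $h\colon\operatorname{Id}_Y(X)\otimes\mathbb{I}\to\operatorname{Id}_Y(X)$ with $h\circ(\operatorname{Id}_Y(X)\otimes\delta_0)=C r\circ i$, $h\circ(\operatorname{Id}_Y(X)\otimes\delta_1)=1$ and $h\circ(C r\otimes\mathbb{I})=C r\circ\pi_0$, where $\pi_0\colon X\otimes\mathbb{I}\to X$ is the projection, and the maps induced by a morphism of fibrations commute with the chosen $i$ and $h$. -/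

import Mathlib

open CategoryTheory CategoryTheory.Limits CategoryTheory.MonoidalCategory
open CategoryTheory.SemiCartesianMonoidalCategory

universe v u v' u'

/-! ## Structures over monads and copointed endofunctors -/

namespace AlgModel

section Structures

variable {D : Type u} [Category.{v} D] {D' : Type u'} [Category.{v'} D']

/-- A structure of algebra over the monad `T` on a fixed object `X`. -/
structure AlgStr (T : Monad D) (X : D) where
  a : T.obj X ⟶ X
  unit : T.η.app X ≫ a = 𝟙 X
  assoc : T.μ.app X ≫ a = T.map a ≫ a

/-- `φ` is a morphism of `T`-algebras between the given structures. -/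
def AlgStr.IsHom {T : Monad D} {X Y : D} (s : AlgStr T X) (t : AlgStr T Y) (φ : X ⟶ Y) : Prop :=
  T.map φ ≫ t.a = s.a ≫ φ

/-- A structure of coalgebra over the copointed endofunctor underlying the comonad `G`, on a
fixed object `X` (no compatibility with the comultiplication is required). -/
structure CoptStr (G : Comonad D) (X : D) where
  a : X ⟶ G.obj X
  counit : a ≫ G.ε.app X = 𝟙 X

/-- `φ` is a morphism of coalgebras over the copointed endofunctor underlying `G`. -/
def CoptStr.IsHom {G : Comonad D} {X Y : D} (s : CoptStr G X) (t : CoptStr G Y)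
    (φ : X ⟶ Y) : Prop :=
  s.a ≫ G.map φ = φ ≫ t.a

/-- The functor `H` can be lifted to a functor between categories of monad algebras: to a
`T`-algebra structure on `X` is assigned a `T'`-algebra structure on `H X`, functorially. -/
def LiftsToAlgebras (T : Monad D) (T' : Monad D') (H : D ⥤ D') : Prop :=
  ∃ s : ∀ X : T.Algebra, AlgStr T' (H.obj X.A),
    ∀ ⦃X Y : T.Algebra⦄ (φ : X ⟶ Y), (s X).IsHom (s Y) (H.map φ.f)

/-- The functor `H` can be lifted to a functor between categories of coalgebras for the
copointed endofunctors underlying `G` and `G'`. -/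
def LiftsToCoalgebras (G : Comonad D) (G' : Comonad D') (H : D ⥤ D') : Prop :=
  ∃ s : ∀ X : D, CoptStr G X → CoptStr G' (H.obj X),
    ∀ ⦃X Y : D⦄ (a : CoptStr G X) (b : CoptStr G Y) (φ : X ⟶ Y),
      a.IsHom b φ → (s X a).IsHom (s Y b) (H.map φ)

/-- `Δ : G T ⟶ T G` is a distributive law of the comonad `G` over the monad `T`. -/
structure IsDistributiveLaw (G : Comonad D) (T : Monad D)
    (Δ : T.toFunctor ⋙ G.toFunctor ⟶ G.toFunctor ⋙ T.toFunctor) : Prop where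
  unit : ∀ X : D, G.map (T.η.app X) ≫ Δ.app X = T.η.app (G.obj X)
  counit : ∀ X : D, Δ.app X ≫ T.map (G.ε.app X) = G.ε.app (T.obj X)
  mul : ∀ X : D, G.map (T.μ.app X) ≫ Δ.app X =
    Δ.app (T.obj X) ≫ T.map (Δ.app X) ≫ T.μ.app (G.obj X)
  comul : ∀ X : D, Δ.app X ≫ T.map (G.δ.app X) =
    G.δ.app (T.obj X) ≫ G.map (Δ.app X) ≫ Δ.app (G.obj X)

end Structures

/-! ## Algebraic weak factorisation systems -/

section Awfs

variable (C : Type u) [Category.{v} C]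

/-- A functorial factorisation `X ⟶ K f ⟶ Y` of the morphisms `f : X ⟶ Y`. -/
structure FunctorialFactorisation where
  K : Arrow C ⥤ C
  l : Arrow.leftFunc ⟶ K
  r : K ⟶ Arrow.rightFunc
  fac : l ≫ r = Arrow.leftToRight

variable {C}

namespace FunctorialFactorisation

variable (E : FunctorialFactorisation C)

lemma fac_app (f : Arrow C) : E.l.app f ≫ E.r.app f = f.hom := by
  rw [← NatTrans.comp_app, E.fac]; rfl

lemma l_naturality {f g : Arrow C} (φ : f ⟶ g) :
    φ.left ≫ E.l.app g = E.l.app f ≫ E.K.map φ := E.l.naturality φ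

lemma r_naturality {f g : Arrow C} (φ : f ⟶ g) :
    E.K.map φ ≫ E.r.app g = E.r.app f ≫ φ.right := E.r.naturality φ

/-- The endofunctor `f ↦ L f` of the arrow category. -/
def L : Arrow C ⥤ Arrow C where
  obj f := Arrow.mk (E.l.app f)
  map φ := Arrow.homMk φ.left (E.K.map φ) (E.l_naturality φ)
  map_id f := Arrow.hom_ext _ _ rfl (E.K.map_id f)
  map_comp φ ψ := Arrow.hom_ext _ _ rfl (E.K.map_comp φ ψ)

/-- The endofunctor `f ↦ R f` of the arrow category. -/
def R : Arrow C ⥤ Arrow C where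
  obj f := Arrow.mk (E.r.app f)
  map φ := Arrow.homMk (E.K.map φ) φ.right (E.r_naturality φ)
  map_id f := Arrow.hom_ext _ _ (E.K.map_id f) rfl
  map_comp φ ψ := Arrow.hom_ext _ _ (E.K.map_comp φ ψ) rfl

/-- The canonical copoint `(1, R f) : L f ⟶ f`. -/
def counit : E.L ⟶ 𝟭 (Arrow C) where
  app f := Arrow.homMk (f := E.L.obj f) (g := f) (𝟙 f.left) (E.r.app f)
    ((Category.id_comp f.hom).trans (E.fac_app f).symm)
  naturality _ _ φ := Arrow.hom_ext _ _
    ((Category.comp_id φ.left).trans (Category.id_comp φ.left).symm) (E.r_naturality φ)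

/-- The canonical point `(L f, 1) : f ⟶ R f`. -/
def unit : 𝟭 (Arrow C) ⟶ E.R where
  app f := Arrow.homMk (f := f) (g := E.R.obj f) (E.l.app f) (𝟙 f.right)
    ((E.fac_app f).trans (Category.comp_id f.hom).symm)
  naturality _ _ φ := Arrow.hom_ext _ _
    (E.l_naturality φ) ((Category.comp_id φ.right).trans (Category.id_comp φ.right).symm)

end FunctorialFactorisation

variable (C) in
/-- A functorial factorisation with a comultiplication making `L` into a comonad and a
multiplication making `R` into a monad. -/
structure AwfsData extends FunctorialFactorisation C where
  comul : toFunctorialFactorisation.L ⟶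
    toFunctorialFactorisation.L ⋙ toFunctorialFactorisation.L
  coassoc : ∀ f : Arrow C, comul.app f ≫ toFunctorialFactorisation.L.map (comul.app f) =
    comul.app f ≫ comul.app (toFunctorialFactorisation.L.obj f)
  left_counit : ∀ f : Arrow C, comul.app f ≫
    toFunctorialFactorisation.counit.app (toFunctorialFactorisation.L.obj f) = 𝟙 _
  right_counit : ∀ f : Arrow C, comul.app f ≫
    toFunctorialFactorisation.L.map (toFunctorialFactorisation.counit.app f) = 𝟙 _
  mul : toFunctorialFactorisation.R ⋙ toFunctorialFactorisation.R ⟶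
    toFunctorialFactorisation.R
  assoc : ∀ f : Arrow C, toFunctorialFactorisation.R.map (mul.app f) ≫ mul.app f =
    mul.app (toFunctorialFactorisation.R.obj f) ≫ mul.app f
  left_unit : ∀ f : Arrow C,
    toFunctorialFactorisation.unit.app (toFunctorialFactorisation.R.obj f) ≫ mul.app f = 𝟙 _
  right_unit : ∀ f : Arrow C,
    toFunctorialFactorisation.R.map (toFunctorialFactorisation.unit.app f) ≫ mul.app f = 𝟙 _

namespace AwfsData

variable (A : AwfsData C)

/-- The comonad `L` on the arrow category. -/
def comonad : Comonad (Arrow C) where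
  toFunctor := A.L
  ε := A.counit
  δ := A.comul
  coassoc := A.coassoc
  left_counit := A.left_counit
  right_counit := A.right_counit

/-- The monad `R` on the arrow category. -/
def monad : Monad (Arrow C) where
  toFunctor := A.R
  η := A.unit
  μ := A.mul
  assoc := A.assoc
  left_unit := A.left_unit
  right_unit := A.right_unit

/-- The canonical map `L R ⟶ R L`. At `f`, it is the commutative square from
`L (R f) : K f ⟶ K (R f)` to `R (L f) : K (L f) ⟶ K f` whose top side `K f ⟶ K (L f)` comes
from the comultiplication and whose bottom side `K (R f) ⟶ K f` comes from the
multiplication. -/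
def canonical : A.R ⋙ A.L ⟶ A.L ⋙ A.R where
  app f := Arrow.homMk (f := A.L.obj (A.R.obj f)) (g := A.R.obj (A.L.obj f))
    (A.comul.app f).right (A.mul.app f).left
    ((congrArg (fun φ => Arrow.Hom.right φ) (A.left_counit f)).trans
      (congrArg (fun φ => Arrow.Hom.left φ) (A.left_unit f)).symm)
  naturality _ _ φ := Arrow.hom_ext _ _
    (congrArg (fun ψ => Arrow.Hom.right ψ) (A.comul.naturality φ))
    (congrArg (fun ψ => Arrow.Hom.left ψ) (A.mul.naturality φ))

end AwfsData

variable (C) in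
/-- An algebraic weak factorisation system `(L, R)`. -/
structure Awfs extends AwfsData C where
  distrib : IsDistributiveLaw toAwfsData.comonad toAwfsData.monad toAwfsData.canonical

/-- An awfs is pullback stable if `R`, as given by functoriality of the factorisation, sends
pullback squares to pullback squares. -/
def Awfs.PullbackStable (A : Awfs C) : Prop :=
  ∀ ⦃f g : Arrow C⦄ (φ : f ⟶ g), IsPullback φ.left f.hom g.hom φ.right →
    IsPullback (A.K.map φ) (A.r.app f) (A.r.app g) φ.right

/-- A morphism of functorial factorisations. -/
structure FactorisationHom (A B : FunctorialFactorisation C) where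
  ξ : A.K ⟶ B.K
  l_ξ : ∀ f : Arrow C, A.l.app f ≫ ξ.app f = B.l.app f
  ξ_r : ∀ f : Arrow C, ξ.app f ≫ B.r.app f = A.r.app f

/-- The square `(1, ξ_f) : L f ⟶ L' f`. -/
def FactorisationHom.left {A B : FunctorialFactorisation C} (x : FactorisationHom A B)
    (f : Arrow C) : A.L.obj f ⟶ B.L.obj f :=
  Arrow.homMk (f := A.L.obj f) (g := B.L.obj f) (𝟙 f.left) (x.ξ.app f)
    ((Category.id_comp (B.l.app f)).trans (x.l_ξ f).symm)

/-- The square `(ξ_f, 1) : R f ⟶ R' f`. -/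
def FactorisationHom.right {A B : FunctorialFactorisation C} (x : FactorisationHom A B)
    (f : Arrow C) : A.R.obj f ⟶ B.R.obj f :=
  Arrow.homMk (f := A.R.obj f) (g := B.R.obj f) (x.ξ.app f) (𝟙 f.right)
    ((x.ξ_r f).trans (Category.comp_id (A.r.app f)).symm)

/-- A morphism of awfs's: a morphism of functorial factorisations which induces a morphism of
comonads `L ⟶ L'` and a morphism of monads `R ⟶ R'`. (Compatibility with the copoint and the
point is automatic.) -/
structure AwfsHom (A B : Awfs C) extends
    FactorisationHom A.toFunctorialFactorisation B.toFunctorialFactorisation where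
  comul_left : ∀ f : Arrow C, toFactorisationHom.left f ≫ B.comul.app f =
    A.comul.app f ≫ toFactorisationHom.left (A.L.obj f) ≫ B.L.map (toFactorisationHom.left f)
  mul_right : ∀ f : Arrow C, A.mul.app f ≫ toFactorisationHom.right f =
    A.R.map (toFactorisationHom.right f) ≫ toFactorisationHom.right (B.R.obj f) ≫ B.mul.app f

variable (C) in
/-- A pre algebraic model structure: awfs's `(Cᵗ, F)` and `(C, Fᵗ)` with a comparison map. -/
structure PreAms where
  trivCofFib : Awfs C
  cofTrivFib : Awfs C
  comparison : AwfsHom trivCofFib cofTrivFib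

namespace PreAms

variable (Q : PreAms C)

/-- The comonad `Cᵗ`; the trivial cofibrations are its copointed coalgebras. -/
abbrev Ct : Comonad (Arrow C) := Q.trivCofFib.comonad

/-- The monad `F`; the fibrations are its algebras. -/
abbrev F : Monad (Arrow C) := Q.trivCofFib.monad

/-- The comonad `C`; the cofibrations are its copointed coalgebras. -/
abbrev Cof : Comonad (Arrow C) := Q.cofTrivFib.comonad

/-- The monad `Fᵗ`; the trivial fibrations are its algebras. -/
abbrev Ft : Monad (Arrow C) := Q.cofTrivFib.monad

end PreAms

end Awfs

/-! ## Very good path objects -/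

noncomputable section PathObjects

variable {C : Type u} [Category.{v} C] [HasFiniteLimits C]

variable (C) in
/-- The functor sending `f : X ⟶ Y` to `X ×_Y X`. -/
def selfPullback : Arrow C ⥤ C where
  obj f := pullback f.hom f.hom
  map φ := pullback.map _ _ _ _ φ.left φ.left φ.right (Arrow.w φ).symm (Arrow.w φ).symm
  map_id _ := pullback.map_id
  map_comp _ _ := (pullback.map_comp ..).symm

/-- A factorisation `X ⟶ P f ⟶ X ×_Y X` of the diagonal, for each algebra `f : X ⟶ Y` over the
monad `T`, functorial in the algebra `f`. -/
structure DiagonalFactorisation (T : Monad (Arrow C)) where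
  P : T.Algebra ⥤ C
  r : T.forget ⋙ Arrow.leftFunc ⟶ P
  p : P ⟶ T.forget ⋙ selfPullback C
  fac : ∀ f : T.Algebra, r.app f ≫ p.app f = pullback.diagonal f.A.hom

/-- The square from `r_f` to `r_g` induced by a morphism of algebras `f ⟶ g`. -/
def DiagonalFactorisation.rSquare {T : Monad (Arrow C)} (E : DiagonalFactorisation T)
    {f g : T.Algebra} (φ : f ⟶ g) : Arrow.mk (E.r.app f) ⟶ Arrow.mk (E.r.app g) :=
  Arrow.homMk φ.f.left (E.P.map φ) (E.r.naturality φ)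

/-- The square from `p_f` to `p_g` induced by a morphism of algebras `f ⟶ g`. -/
def DiagonalFactorisation.pSquare {T : Monad (Arrow C)} (E : DiagonalFactorisation T)
    {f g : T.Algebra} (φ : f ⟶ g) : Arrow.mk (E.p.app f) ⟶ Arrow.mk (E.p.app g) :=
  Arrow.homMk (E.P.map φ) ((selfPullback C).map φ.f) (E.p.naturality φ)

/-- A stable functorial choice of very good path objects for the awfs `A`, written `(Cᵗ, F)`: a
functorial factorisation of the diagonals of `F`-algebras, with functorial (copointed)
`Cᵗ`-coalgebra structures on the maps `r_f` and `F`-algebra structures on the maps `p_f`, such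
that morphisms of algebras whose underlying square is a pullback induce pullback squares between
the maps `p_f`. -/
structure StableFunctorialChoice (A : Awfs C) extends DiagonalFactorisation A.monad where
  rStr : ∀ f : A.monad.Algebra, CoptStr A.comonad (Arrow.mk (r.app f))
  rStr_hom : ∀ ⦃f g : A.monad.Algebra⦄ (φ : f ⟶ g),
    (rStr f).IsHom (rStr g) (toDiagonalFactorisation.rSquare φ)
  pStr : ∀ f : A.monad.Algebra, AlgStr A.monad (Arrow.mk (p.app f))
  pStr_hom : ∀ ⦃f g : A.monad.Algebra⦄ (φ : f ⟶ g),
    (pStr f).IsHom (pStr g) (toDiagonalFactorisation.pSquare φ)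
  stable : ∀ ⦃f g : A.monad.Algebra⦄ (φ : f ⟶ g),
    IsPullback φ.f.left f.A.hom g.A.hom φ.f.right →
      IsPullback (P.map φ) (p.app f) (p.app g) ((selfPullback C).map φ.f)

end PathObjects

/-! ## Intervals, pullback hom, and the mapping path space -/

noncomputable section Interval

variable {C : Type u} [Category.{v} C] [SemiCartesianMonoidalCategory C]

variable (C) in
/-- An interval object: an object with two endpoints. -/
structure Interval where
  I : C
  δ₀ : 𝟙_ C ⟶ I
  δ₁ : 𝟙_ C ⟶ I

/-- The inclusion `[δ₀, δ₁]` of the boundary `2 = 1 + 1` in the interval. -/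
def Interval.boundary [HasFiniteColimits C] (J : Interval C) : (𝟙_ C) ⨿ (𝟙_ C) ⟶ J.I :=
  coprod.desc J.δ₀ J.δ₁

/-- A structured homotopy `h : X ⊗ I ⟶ Y` from `f` to `g`. -/
structure StructuredHomotopy (J : Interval C) {X Y : C} (f g : X ⟶ Y) where
  h : X ⊗ J.I ⟶ Y
  left : (ρ_ X).inv ≫ X ◁ J.δ₀ ≫ h = f
  right : (ρ_ X).inv ≫ X ◁ J.δ₁ ≫ h = g

/-- A structured strong deformation retract from `X` to `Y` with section `s : Y ⟶ X`. -/
structure StrongDeformationRetract (J : Interval C) {X Y : C} (s : Y ⟶ X) where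
  f : X ⟶ Y
  section_retraction : s ≫ f = 𝟙 Y
  homotopy : StructuredHomotopy J (f ≫ s) (𝟙 X)
  constant : s ▷ J.I ≫ homotopy.h = fst Y J.I ≫ s

/-- The maps `k : X ⟶ X'` and `l : Y ⟶ Y'` preserve the given strong deformation retracts. -/
structure StrongDeformationRetract.IsHom {J : Interval C} {X Y X' Y' : C} {s : Y ⟶ X}
    {s' : Y' ⟶ X'} (d : StrongDeformationRetract J s) (d' : StrongDeformationRetract J s')
    (k : X ⟶ X') (l : Y ⟶ Y') : Prop where
  retraction : d.f ≫ l = k ≫ d'.f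
  inclusion : s ≫ k = l ≫ s'
  homotopy : k ▷ J.I ≫ d'.homotopy.h = d.homotopy.h ≫ k

variable {J : Interval C} {P : C ⥤ C} (adj : tensorRight J.I ⊣ P)

/-- Evaluation `P X ⟶ X` of paths at a point `d` of the interval. -/
def evalHom (d : 𝟙_ C ⟶ J.I) (X : C) : P.obj X ⟶ X :=
  (ρ_ (P.obj X)).inv ≫ P.obj X ◁ d ≫ adj.counit.app X

/-- Constant paths `Y ⟶ P Y`: the transpose of the projection `Y ⊗ I ⟶ Y`. -/
def constHom (Y : C) : Y ⟶ P.obj Y := adj.homEquiv Y Y (fst Y J.I)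

lemma evalHom_naturality (d : 𝟙_ C ⟶ J.I) {X Y : C} (f : X ⟶ Y) :
    P.map f ≫ evalHom adj d Y = evalHom adj d X ≫ f := by
  have h : P.map f ▷ J.I ≫ adj.counit.app Y = adj.counit.app X ≫ f := adj.counit.naturality f
  have h' : evalHom adj d X ≫ f =
      (ρ_ (P.obj X)).inv ≫ P.obj X ◁ d ≫ adj.counit.app X ≫ f :=
    (Category.assoc _ _ _).trans (congrArg _ (Category.assoc _ _ _))
  rw [h', ← h, evalHom, rightUnitor_inv_naturality_assoc, ← whisker_exchange_assoc]

lemma constHom_naturality {X Y : C} (f : X ⟶ Y) :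
    f ≫ constHom adj Y = constHom adj X ≫ P.map f := by
  have h : f ▷ J.I ≫ fst Y J.I = fst X J.I ≫ f := by
    rw [fst_def, fst_def, ← whisker_exchange_assoc, Category.assoc, rightUnitor_naturality]
  exact (adj.homEquiv_naturality_left f (fst Y J.I)).symm.trans
    ((congrArg (adj.homEquiv X Y) h).trans (adj.homEquiv_naturality_right (fst X J.I) f))

lemma constHom_evalHom (d : 𝟙_ C ⟶ J.I) (Y : C) :
    constHom adj Y ≫ evalHom adj d Y = 𝟙 Y := by
  have h : constHom adj Y ▷ J.I ≫ adj.counit.app Y = fst Y J.I :=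
    (adj.homEquiv_counit (X := Y) (g := constHom adj Y)).symm.trans
      ((adj.homEquiv Y Y).symm_apply_apply (fst Y J.I))
  have h' : d ≫ isTerminalTensorUnit.from J.I = 𝟙 _ := isTerminalTensorUnit.hom_ext _ _
  rw [evalHom, rightUnitor_inv_naturality_assoc, ← whisker_exchange_assoc, h, fst_def,
    ← whiskerLeft_comp_assoc, h']
  simp

/-- Evaluation of paths at a point `d` of the interval, as a natural transformation. -/
def evalAt (d : 𝟙_ C ⟶ J.I) : P ⟶ 𝟭 C where
  app X := evalHom adj d X
  naturality _ _ f := evalHom_naturality adj d f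

variable [HasFiniteLimits C]

/-- The pullback hom construction, for a natural transformation `τ : V ⟶ U`. When `V` and `U` are
`hom(B, -)` and `hom(A, -)`, and `τ` is `hom(i, -)` for some `i : A ⟶ B`, this sends `f : X ⟶ Y` to
the map `hom(B, X) ⟶ hom(A, X) ×_{hom(A, Y)} hom(B, Y)`. -/
def pullbackHom {U V : C ⥤ C} (τ : V ⟶ U) : Arrow C ⥤ Arrow C where
  obj f := Arrow.mk (pullback.lift (f := U.map f.hom) (g := τ.app f.right)
    (τ.app f.left) (V.map f.hom) (τ.naturality f.hom).symm)
  map {f g} φ := Arrow.homMk' (V.map φ.left)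
    (pullback.map (U.map f.hom) (τ.app f.right) (U.map g.hom) (τ.app g.right)
      (U.map φ.left) (V.map φ.right) (U.map φ.right)
      (by rw [← U.map_comp, ← U.map_comp]; exact congrArg U.map φ.w.symm)
      (τ.naturality φ.right).symm)
    (by
      have h : V.map φ.left ≫ V.map g.hom = V.map f.hom ≫ V.map φ.right := by
        rw [← V.map_comp, ← V.map_comp]; exact congrArg V.map φ.w
      apply pullback.hom_ext
      · rw [Category.assoc, Category.assoc, pullback.lift_fst, pullback.lift_fst,
          pullback.lift_fst_assoc, τ.naturality]
      · rw [Category.assoc, Category.assoc, pullback.lift_snd, pullback.lift_snd,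
          pullback.lift_snd_assoc, h])
  map_id f := Arrow.hom_ext _ _ (V.map_id _) (by
    apply pullback.hom_ext
    · exact (pullback.lift_fst _ _ _).trans
        ((congrArg (_ ≫ ·) (U.map_id _)).trans
          ((Category.comp_id _).trans (Category.id_comp _).symm))
    · exact (pullback.lift_snd _ _ _).trans
        ((congrArg (_ ≫ ·) (V.map_id _)).trans
          ((Category.comp_id _).trans (Category.id_comp _).symm)))
  map_comp {f g h} φ ψ := Arrow.hom_ext _ _ (V.map_comp _ _)
    (pullback.hom_ext (f := U.map h.hom) (g := τ.app h.right)
      (by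
        refine (pullback.lift_fst _ _ _).trans ((congrArg (_ ≫ ·) (U.map_comp _ _)).trans ?_)
        refine Eq.trans ?_ (Category.assoc _ _ _).symm
        refine Eq.trans ?_ (congrArg (_ ≫ ·) (pullback.lift_fst _ _ _).symm)
        refine Eq.trans ?_ (Category.assoc _ _ _)
        refine Eq.trans ?_ (congrArg (· ≫ U.map ψ.left) (pullback.lift_fst _ _ _).symm)
        exact (Category.assoc _ _ _).symm)
      (by
        refine (pullback.lift_snd _ _ _).trans ((congrArg (_ ≫ ·) (V.map_comp _ _)).trans ?_)
        refine Eq.trans ?_ (Category.assoc _ _ _).symm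
        refine Eq.trans ?_ (congrArg (_ ≫ ·) (pullback.lift_snd _ _ _).symm)
        refine Eq.trans ?_ (Category.assoc _ _ _)
        refine Eq.trans ?_ (congrArg (· ≫ V.map ψ.right) (pullback.lift_snd _ _ _).symm)
        exact (Category.assoc _ _ _).symm))

/-- The pullback hom with an endpoint `d : 1 ⟶ I`; here `hom(1, X) = X` and `hom(I, X) = P X`. -/
def endpointHom (d : 𝟙_ C ⟶ J.I) : Arrow C ⥤ Arrow C := pullbackHom (evalAt adj d)

variable (C) in
/-- The functor `X ↦ hom(2, X) = X × X`. -/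
def square : C ⥤ C where
  obj X := X ⨯ X
  map f := Limits.prod.map f f

/-- The restriction `hom(I, X) ⟶ hom(2, X)` along `[δ₀, δ₁]`. -/
def endpoints : P ⟶ square C where
  app X := prod.lift (evalHom adj J.δ₀ X) (evalHom adj J.δ₁ X)
  naturality X Y f := by
    change P.map f ≫ prod.lift (evalHom adj J.δ₀ Y) (evalHom adj J.δ₁ Y) =
      prod.lift (evalHom adj J.δ₀ X) (evalHom adj J.δ₁ X) ≫ Limits.prod.map f f
    rw [prod.comp_lift, prod.lift_map, evalHom_naturality, evalHom_naturality]

/-- The pullback hom with the boundary inclusion `[δ₀, δ₁] : 2 ⟶ I`. -/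
def boundaryHom : Arrow C ⥤ Arrow C := pullbackHom (endpoints adj)

/-- The mapping path space `P_Y(X)` of `f : X ⟶ Y`: the pullback of `P X ⟶ P Y` along the inclusion
`Y ⟶ P Y` of the constant paths. -/
def mappingPath : Arrow C ⥤ C where
  obj f := pullback (P.map f.hom) (constHom adj f.right)
  map {f g} φ := pullback.map (P.map f.hom) (constHom adj f.right)
    (P.map g.hom) (constHom adj g.right) (P.map φ.left) φ.right (P.map φ.right)
    (by rw [← P.map_comp, ← P.map_comp]; exact congrArg P.map φ.w.symm)
    (constHom_naturality adj φ.right).symm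
  map_id f := by
    apply pullback.hom_ext
    · exact (pullback.lift_fst _ _ _).trans
        ((congrArg (_ ≫ ·) (P.map_id _)).trans
          ((Category.comp_id _).trans (Category.id_comp _).symm))
    · exact (pullback.lift_snd _ _ _).trans
        ((Category.comp_id _).trans (Category.id_comp _).symm)
  map_comp φ ψ := by
    refine Eq.trans ?_ (pullback.map_comp ..).symm
    apply pullback.hom_ext
    · exact (pullback.lift_fst _ _ _).trans
        ((congrArg (_ ≫ ·) (P.map_comp _ _)).trans (pullback.lift_fst _ _ _).symm)
    · exact (pullback.lift_snd _ _ _).trans (pullback.lift_snd _ _ _).symm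

/-- The projection `P_Y(X) ⟶ P X`. -/
def pathFst (f : Arrow C) : (mappingPath adj).obj f ⟶ P.obj f.left :=
  pullback.fst (P.map f.hom) (constHom adj f.right)

/-- The projection `P_Y(X) ⟶ Y`. -/
def pathSnd (f : Arrow C) : (mappingPath adj).obj f ⟶ f.right :=
  pullback.snd (P.map f.hom) (constHom adj f.right)

lemma path_condition (f : Arrow C) :
    pathFst adj f ≫ P.map f.hom = pathSnd adj f ≫ constHom adj f.right :=
  pullback.condition

lemma map_pathFst {f g : Arrow C} (φ : f ⟶ g) :
    (mappingPath adj).map φ ≫ pathFst adj g = pathFst adj f ≫ P.map φ.left :=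
  pullback.lift_fst _ _ _

lemma map_pathSnd {f g : Arrow C} (φ : f ⟶ g) :
    (mappingPath adj).map φ ≫ pathSnd adj g = pathSnd adj f ≫ φ.right :=
  pullback.lift_snd _ _ _

lemma path_hom_ext {f : Arrow C} {W : C} {a b : W ⟶ (mappingPath adj).obj f}
    (h₁ : a ≫ pathFst adj f = b ≫ pathFst adj f)
    (h₂ : a ≫ pathSnd adj f = b ≫ pathSnd adj f) : a = b :=
  pullback.hom_ext h₁ h₂

/-- The reflexivity map `r : X ⟶ P_Y(X)`. -/
def reflHom (f : Arrow C) : f.left ⟶ (mappingPath adj).obj f :=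
  pullback.lift (constHom adj f.left) f.hom (constHom_naturality adj f.hom).symm

lemma reflHom_pathFst (f : Arrow C) : reflHom adj f ≫ pathFst adj f = constHom adj f.left :=
  pullback.lift_fst _ _ _

lemma reflHom_pathSnd (f : Arrow C) : reflHom adj f ≫ pathSnd adj f = f.hom :=
  pullback.lift_snd _ _ _

lemma reflHom_naturality {f g : Arrow C} (φ : f ⟶ g) :
    φ.left ≫ reflHom adj g = reflHom adj f ≫ (mappingPath adj).map φ := by
  apply path_hom_ext
  · rw [Category.assoc, Category.assoc, map_pathFst, reflHom_pathFst, ← Category.assoc,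
      reflHom_pathFst, constHom_naturality]
  · rw [Category.assoc, Category.assoc, map_pathSnd, reflHom_pathSnd, ← Category.assoc,
      reflHom_pathSnd, Arrow.w]

/-- The projection `P_Y(X) ⟶ X` given by the endpoint `d`. -/
def proj (d : 𝟙_ C ⟶ J.I) (f : Arrow C) : (mappingPath adj).obj f ⟶ f.left :=
  pathFst adj f ≫ evalHom adj d f.left

lemma proj_over (d : 𝟙_ C ⟶ J.I) (f : Arrow C) : proj adj d f ≫ f.hom = pathSnd adj f := by
  rw [proj, Category.assoc, ← evalHom_naturality, ← Category.assoc, path_condition,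
    Category.assoc, constHom_evalHom, Category.comp_id]

lemma proj_naturality (d : 𝟙_ C ⟶ J.I) {f g : Arrow C} (φ : f ⟶ g) :
    (mappingPath adj).map φ ≫ proj adj d g = proj adj d f ≫ φ.left := by
  rw [proj, proj, ← Category.assoc, map_pathFst, Category.assoc, Category.assoc,
    evalHom_naturality]

lemma reflHom_proj (d : 𝟙_ C ⟶ J.I) (f : Arrow C) :
    reflHom adj f ≫ proj adj d f = 𝟙 f.left := by
  rw [proj, ← Category.assoc, reflHom_pathFst, constHom_evalHom]

/-- The map `p_f = ⟨p₀, p₁⟩ : P_Y(X) ⟶ X ×_Y X`. -/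
def projPair (f : Arrow C) : (mappingPath adj).obj f ⟶ (selfPullback C).obj f :=
  pullback.lift (proj adj J.δ₀ f) (proj adj J.δ₁ f)
    ((proj_over adj J.δ₀ f).trans (proj_over adj J.δ₁ f).symm)

lemma projPair_naturality {f g : Arrow C} (φ : f ⟶ g) :
    (mappingPath adj).map φ ≫ projPair adj g = projPair adj f ≫ (selfPullback C).map φ := by
  have h₀ : projPair adj g ≫ pullback.fst g.hom g.hom = proj adj J.δ₀ g :=
    pullback.lift_fst _ _ _
  have h₁ : projPair adj g ≫ pullback.snd g.hom g.hom = proj adj J.δ₁ g :=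
    pullback.lift_snd _ _ _
  have k₀ : projPair adj f ≫ pullback.fst f.hom f.hom = proj adj J.δ₀ f :=
    pullback.lift_fst _ _ _
  have k₁ : projPair adj f ≫ pullback.snd f.hom f.hom = proj adj J.δ₁ f :=
    pullback.lift_snd _ _ _
  have m₀ : (selfPullback C).map φ ≫ pullback.fst g.hom g.hom =
      pullback.fst f.hom f.hom ≫ φ.left := pullback.lift_fst _ _ _
  have m₁ : (selfPullback C).map φ ≫ pullback.snd g.hom g.hom =
      pullback.snd f.hom f.hom ≫ φ.left := pullback.lift_snd _ _ _
  refine pullback.hom_ext (f := g.hom) (g := g.hom) ?_ ?_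
  · exact (Category.assoc _ _ _).trans ((congrArg (_ ≫ ·) h₀).trans
      ((proj_naturality adj J.δ₀ φ).trans ((congrArg (· ≫ φ.left) k₀.symm).trans
        ((Category.assoc _ _ _).trans ((congrArg (_ ≫ ·) m₀.symm).trans
          (Category.assoc _ _ _).symm)))))
  · exact (Category.assoc _ _ _).trans ((congrArg (_ ≫ ·) h₁).trans
      ((proj_naturality adj J.δ₁ φ).trans ((congrArg (· ≫ φ.left) k₁.symm).trans
        ((Category.assoc _ _ _).trans ((congrArg (_ ≫ ·) m₁.symm).trans
          (Category.assoc _ _ _).symm)))))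

lemma reflHom_projPair (f : Arrow C) :
    reflHom adj f ≫ projPair adj f = pullback.diagonal f.hom := by
  have k₀ : projPair adj f ≫ pullback.fst f.hom f.hom = proj adj J.δ₀ f :=
    pullback.lift_fst _ _ _
  have k₁ : projPair adj f ≫ pullback.snd f.hom f.hom = proj adj J.δ₁ f :=
    pullback.lift_snd _ _ _
  refine pullback.hom_ext (f := f.hom) (g := f.hom) ?_ ?_
  · exact (Category.assoc _ _ _).trans ((congrArg (_ ≫ ·) k₀).trans
      ((reflHom_proj adj J.δ₀ f).trans (pullback.lift_fst _ _ _).symm))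
  · exact (Category.assoc _ _ _).trans ((congrArg (_ ≫ ·) k₁).trans
      ((reflHom_proj adj J.δ₁ f).trans (pullback.lift_snd _ _ _).symm))

/-- The functor sending `f : X ⟶ Y` to the map `r : X ⟶ P_Y(X)`. -/
def reflArrow : Arrow C ⥤ Arrow C where
  obj f := Arrow.mk (reflHom adj f)
  map φ := Arrow.homMk' φ.left ((mappingPath adj).map φ) (reflHom_naturality adj φ)
  map_id f := Arrow.hom_ext _ _ rfl ((mappingPath adj).map_id f)
  map_comp φ ψ := Arrow.hom_ext _ _ rfl ((mappingPath adj).map_comp φ ψ)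

/-- The factorisation `X ⟶ Id_Y(X) ⟶ X ×_Y X` of the diagonal of a fibration `f : X ⟶ Y`, obtained
by factoring `r : X ⟶ P_Y(X)` through the awfs `(C, Fᵗ)` as `Fᵗ r ∘ C r` and composing `Fᵗ r` with
`p_f : P_Y(X) ⟶ X ×_Y X`. -/
def idFactorisation (Q : PreAms C) : DiagonalFactorisation Q.F where
  P := Q.F.forget ⋙ reflArrow adj ⋙ Q.cofTrivFib.K
  r :=
    { app f := Q.cofTrivFib.l.app ((reflArrow adj).obj f.A)
      naturality _ _ φ := Q.cofTrivFib.l_naturality ((reflArrow adj).map φ.f) }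
  p :=
    { app f := Q.cofTrivFib.r.app ((reflArrow adj).obj f.A) ≫ projPair adj f.A
      naturality f g φ := (Category.assoc _ _ _).symm.trans
        ((congrArg (· ≫ projPair adj g.A)
          (Q.cofTrivFib.r_naturality ((reflArrow adj).map φ.f))).trans
        ((Category.assoc _ _ _).trans
        ((congrArg (Q.cofTrivFib.r.app ((reflArrow adj).obj f.A) ≫ ·)
          (projPair_naturality adj φ.f)).trans (Category.assoc _ _ _).symm))) }
  fac f := (Category.assoc _ _ _).symm.trans
    ((congrArg (· ≫ projPair adj f.A)
      (Q.cofTrivFib.fac_app ((reflArrow adj).obj f.A))).trans (reflHom_projPair adj f.A))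

end Interval

end AlgModel

/-! The proof rests on one map, the retraction `i = p₀ ∘ Fᵗ r : Id_Y(X) ⟶ X` of `C r`. Here `p₀` is
a pullback of the pullback hom with `δ₀` (`isPullback_proj`), hence a trivial fibration, and `Fᵗ r`
is a free algebra, so `i` is a trivial fibration. On the other side `C r` is a cofree coalgebra, so
its pushout product with the boundary of the interval is a cofibration. Lifting that cofibration
against `i` yields a homotopy from `C r ∘ i` to the identity which is constant on `X`: thus `C r` is
a strong deformation retract (`sdrOfTrivialFibration`).

A cofibration `m : A ⟶ B` that is a strong deformation retract lifts against every fibration `g`.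
The homotopy, mapped to the base of `g`, is a family of paths whose sources lift through the
retraction. The trivial fibration given by the pullback hom of `g` with `δ₀` lifts the whole paths,
keeping them constant on `A`, and their values at `δ₁` form the filler (`sdrFill`). A copointed
`Cᵗ`-coalgebra structure on `m` is exactly a filler of the unit square `m ⟶ F m`, so this makes `m`
a trivial cofibration (`trivialCofibration`).

The endpoint map `p_f` is a pullback of the pullback hom with the boundary (`isPullback_projPair`),
hence a fibration. The map `Fᵗ r` becomes a fibration along `ξ`, and algebras compose because of the
distributive law (`AlgStr.comp`).

Functoriality holds because every filler is the explicit composite `fill`, natural in all structures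
(`fill_naturality`), and because pullback, restriction and composition of algebras respect
morphisms. Stability holds because `P_Y(X)`, `r` and `p_f` are built from pullbacks and the right
adjoint `P`, so they carry pullback squares to pullback squares, which `(C, Fᵗ)` preserves. -/

namespace AlgModel

/-! ### Algebras and coalgebras of an awfs, described by their underlying maps. -/

section AwfsAlgebra

variable {C : Type u} [Category.{v} C]

namespace FunctorialFactorisation

variable (E : FunctorialFactorisation C)

/-- The left part `X ⟶ K f` of the factorisation of `f : X ⟶ Y`. -/
def lHom (f : Arrow C) : f.left ⟶ E.K.obj f := E.l.app f

/-- The right part `K f ⟶ Y` of the factorisation of `f : X ⟶ Y`. -/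
def rHom (f : Arrow C) : E.K.obj f ⟶ f.right := E.r.app f

@[simp]
lemma lHom_rHom (f : Arrow C) : E.lHom f ≫ E.rHom f = f.hom := E.fac_app f

lemma lHom_K_map {f g : Arrow C} (φ : f ⟶ g) :
    E.lHom f ≫ E.K.map φ = φ.left ≫ E.lHom g := (E.l_naturality φ).symm

lemma K_map_rHom {f g : Arrow C} (φ : f ⟶ g) :
    E.K.map φ ≫ E.rHom g = E.rHom f ≫ φ.right := E.r_naturality φ

/-- The square `L f ⟶ L g` induced by a square `f ⟶ g`. -/
def lMap {f g : Arrow C} (φ : f ⟶ g) : Arrow.mk (E.lHom f) ⟶ Arrow.mk (E.lHom g) :=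
  Arrow.homMk' φ.left (E.K.map φ) (E.lHom_K_map φ).symm

/-- The square `R f ⟶ R g` induced by a square `f ⟶ g`. -/
def rMap {f g : Arrow C} (φ : f ⟶ g) : Arrow.mk (E.rHom f) ⟶ Arrow.mk (E.rHom g) :=
  Arrow.homMk' (E.K.map φ) φ.right (E.K_map_rHom φ)

@[simp] lemma lMap_left {f g : Arrow C} (φ : f ⟶ g) : (E.lMap φ).left = φ.left := rfl
@[simp] lemma lMap_right {f g : Arrow C} (φ : f ⟶ g) : (E.lMap φ).right = E.K.map φ := rfl
@[simp] lemma rMap_left {f g : Arrow C} (φ : f ⟶ g) : (E.rMap φ).left = E.K.map φ := rfl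
@[simp] lemma rMap_right {f g : Arrow C} (φ : f ⟶ g) : (E.rMap φ).right = φ.right := rfl

/-- A square is determined by its two sides, so equations between values of `K` can be checked side
by side, even when the squares pass through different arrows. -/
lemma K_map_comp_eq {f g g' h : Arrow C}
    {φ : f ⟶ g} {ψ : g ⟶ h} {φ' : f ⟶ g'} {ψ' : g' ⟶ h}
    (h₁ : φ.left ≫ ψ.left = φ'.left ≫ ψ'.left)
    (h₂ : φ.right ≫ ψ.right = φ'.right ≫ ψ'.right) :
    E.K.map φ ≫ E.K.map ψ = E.K.map φ' ≫ E.K.map ψ' := by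
  rw [← E.K.map_comp, ← E.K.map_comp]
  exact congrArg E.K.map (Arrow.hom_ext _ _ h₁ h₂)

lemma K_map_comp_eq' {f g h : Arrow C} {φ : f ⟶ g} {ψ : g ⟶ h} {χ : f ⟶ h}
    (h₁ : φ.left ≫ ψ.left = χ.left) (h₂ : φ.right ≫ ψ.right = χ.right) :
    E.K.map φ ≫ E.K.map ψ = E.K.map χ := by
  rw [← E.K.map_comp]
  exact congrArg E.K.map (Arrow.hom_ext _ _ h₁ h₂)

end FunctorialFactorisation

namespace Awfs

variable (A : Awfs C)

/-- The underlying map `K (R f) ⟶ K f` of the multiplication. -/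
def π (f : Arrow C) : A.K.obj (Arrow.mk (A.rHom f)) ⟶ A.K.obj f := (A.mul.app f).left

/-- The underlying map `K f ⟶ K (L f)` of the comultiplication. -/
def σ (f : Arrow C) : A.K.obj f ⟶ A.K.obj (Arrow.mk (A.lHom f)) := (A.comul.app f).right

lemma lHom_π (f : Arrow C) : A.lHom (Arrow.mk (A.rHom f)) ≫ A.π f = 𝟙 _ :=
  congrArg (fun φ => Arrow.Hom.left φ) (A.left_unit f)

/-- The unit of `R` is the identity on codomains, so the codomain side of the unit law leaves no
choice. The multiplication is therefore determined by `π`. -/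
lemma mul_app_right (f : Arrow C) : (A.mul.app f).right = 𝟙 f.right :=
  (Category.id_comp _).symm.trans (congrArg (fun φ => Arrow.Hom.right φ) (A.left_unit f))

lemma π_rHom (f : Arrow C) : A.π f ≫ A.rHom f = A.rHom (Arrow.mk (A.rHom f)) :=
  (Arrow.w (A.mul.app f)).trans
    ((congrArg (A.r.app (A.R.obj f) ≫ ·) (A.mul_app_right f)).trans (Category.comp_id _))

lemma comul_app_left (f : Arrow C) : (A.comul.app f).left = 𝟙 f.left :=
  (Category.comp_id _).symm.trans (congrArg (fun φ => Arrow.Hom.left φ) (A.left_counit f))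

lemma lHom_σ (f : Arrow C) : A.lHom f ≫ A.σ f = A.lHom (Arrow.mk (A.lHom f)) :=
  (Arrow.w (A.comul.app f)).symm.trans
    ((congrArg (· ≫ A.l.app (A.L.obj f)) (A.comul_app_left f)).trans (Category.id_comp _))

lemma σ_rHom (f : Arrow C) : A.σ f ≫ A.rHom (Arrow.mk (A.lHom f)) = 𝟙 _ :=
  congrArg (fun φ => Arrow.Hom.right φ) (A.left_counit f)

lemma π_naturality {f g : Arrow C} (φ : f ⟶ g) :
    A.π f ≫ A.K.map φ = A.K.map (A.rMap φ) ≫ A.π g :=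
  (congrArg (fun ψ => Arrow.Hom.left ψ) (A.mul.naturality φ)).symm

lemma σ_naturality {f g : Arrow C} (φ : f ⟶ g) :
    A.K.map φ ≫ A.σ g = A.σ f ≫ A.K.map (A.lMap φ) :=
  congrArg (fun ψ => Arrow.Hom.right ψ) (A.comul.naturality φ)

/-- The square `L (R f) ⟶ R (L f)` given by the comultiplication and the multiplication. -/
def canonicalSquare (f : Arrow C) :
    Arrow.mk (A.lHom (Arrow.mk (A.rHom f))) ⟶ Arrow.mk (A.rHom (Arrow.mk (A.lHom f))) :=
  Arrow.homMk' (A.σ f) (A.π f) ((A.σ_rHom f).trans (A.lHom_π f).symm)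

/-- The domain side of the multiplication axiom of the distributive law. This is what makes the
composite of two algebras associative. -/
lemma π_σ (f : Arrow C) :
    A.π f ≫ A.σ f =
      A.σ (Arrow.mk (A.rHom f)) ≫ A.K.map (A.canonicalSquare f) ≫ A.π (Arrow.mk (A.lHom f)) :=
  congrArg (fun φ => Arrow.Hom.left φ) (A.distrib.mul f)

end Awfs

variable {A : Awfs C}

namespace AlgStr

/-- The underlying map `K g ⟶ X` of an algebra structure on `g : X ⟶ Y`. -/
def act {g : Arrow C} (s : AlgStr A.monad g) : A.K.obj g ⟶ g.left := s.a.left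

lemma lHom_act {g : Arrow C} (s : AlgStr A.monad g) : A.lHom g ≫ s.act = 𝟙 _ :=
  congrArg (fun φ => Arrow.Hom.left φ) s.unit

lemma a_right {g : Arrow C} (s : AlgStr A.monad g) : s.a.right = 𝟙 g.right :=
  (Category.id_comp _).symm.trans (congrArg (fun φ => Arrow.Hom.right φ) s.unit)

lemma act_hom {g : Arrow C} (s : AlgStr A.monad g) : s.act ≫ g.hom = A.rHom g :=
  (Arrow.w s.a).trans ((congrArg (A.r.app g ≫ ·) s.a_right).trans (Category.comp_id _))

/-- The structure map of an algebra, as a square `R g ⟶ g`. -/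
def actSquare {g : Arrow C} (s : AlgStr A.monad g) : Arrow.mk (A.rHom g) ⟶ g :=
  Arrow.homMk s.act (𝟙 _) (s.act_hom.trans (Category.comp_id _).symm)

@[simp] lemma actSquare_left {g : Arrow C} (s : AlgStr A.monad g) :
    s.actSquare.left = s.act := rfl

@[simp] lemma actSquare_right {g : Arrow C} (s : AlgStr A.monad g) :
    s.actSquare.right = 𝟙 g.right := rfl

lemma π_act {g : Arrow C} (s : AlgStr A.monad g) :
    A.π g ≫ s.act = A.K.map s.actSquare ≫ s.act := by
  have h : s.a = s.actSquare := Arrow.hom_ext _ _ rfl s.a_right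
  rw [← h]
  exact congrArg (fun φ => Arrow.Hom.left φ) s.assoc

/-- Structure maps are identities on codomains, so only the domain side of the condition has
content. -/
lemma isHom_iff {f g : Arrow C} (s : AlgStr A.monad f) (t : AlgStr A.monad g) (φ : f ⟶ g) :
    s.IsHom t φ ↔ A.K.map φ ≫ t.act = s.act ≫ φ.left :=
  ⟨fun h => congrArg (fun φ => Arrow.Hom.left φ) h, fun h => Arrow.hom_ext _ _ h
    ((congrArg (φ.right ≫ ·) t.a_right).trans ((Category.comp_id _).trans
      ((Category.id_comp _).symm.trans (congrArg (· ≫ φ.right) s.a_right.symm))))⟩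

/-- An algebra structure from its underlying map. -/
def ofAct {g : Arrow C} (a : A.K.obj g ⟶ g.left) (h₁ : A.lHom g ≫ a = 𝟙 _)
    (h₂ : a ≫ g.hom = A.rHom g)
    -- Quantifying over squares with prescribed sides frees the associativity law from the
    -- particular proof of commutativity used to build the structure square.
    (h₃ : ∀ φ : Arrow.mk (A.rHom g) ⟶ g, φ.left = a → φ.right = 𝟙 _ →
      A.π g ≫ a = A.K.map φ ≫ a) :
    AlgStr A.monad g where
  a := Arrow.homMk (f := A.R.obj g) (g := g) a (𝟙 _) (h₂.trans (Category.comp_id _).symm)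
  unit := Arrow.hom_ext _ _ h₁ (Category.comp_id _)
  assoc := Arrow.hom_ext _ _ (h₃ (Arrow.homMk a (𝟙 _) (h₂.trans (Category.comp_id _).symm)) rfl rfl)
    (congrArg (· ≫ 𝟙 g.right) (A.mul_app_right g))

@[simp]
lemma ofAct_act {g : Arrow C} (a : A.K.obj g ⟶ g.left) (h₁ : A.lHom g ≫ a = 𝟙 _)
    (h₂ : a ≫ g.hom = A.rHom g)
    (h₃ : ∀ φ : Arrow.mk (A.rHom g) ⟶ g, φ.left = a → φ.right = 𝟙 _ →
      A.π g ≫ a = A.K.map φ ≫ a) : (ofAct a h₁ h₂ h₃).act = a := rfl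

lemma IsHom.comp {D : Type u'} [Category.{v'} D] {T : Monad D} {X Y Z : D}
    {s : AlgStr T X} {t : AlgStr T Y} {w : AlgStr T Z} {φ : X ⟶ Y} {ψ : Y ⟶ Z}
    (h : s.IsHom t φ) (h' : t.IsHom w ψ) : s.IsHom w (φ ≫ ψ) := by
  rw [IsHom] at *
  rw [T.map_comp, Category.assoc, h', ← Category.assoc, h, Category.assoc]

end AlgStr

namespace CoptStr

/-- The underlying map `B ⟶ K m` of a coalgebra structure on `m : A ⟶ B`. -/
def coact {m : Arrow C} (s : CoptStr A.comonad m) : m.right ⟶ A.K.obj m := s.a.right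

lemma a_left {m : Arrow C} (s : CoptStr A.comonad m) : s.a.left = 𝟙 m.left :=
  (Category.comp_id _).symm.trans (congrArg (fun φ => Arrow.Hom.left φ) s.counit)

lemma coact_rHom {m : Arrow C} (s : CoptStr A.comonad m) : s.coact ≫ A.rHom m = 𝟙 _ :=
  congrArg (fun φ => Arrow.Hom.right φ) s.counit

lemma hom_coact {m : Arrow C} (s : CoptStr A.comonad m) : m.hom ≫ s.coact = A.lHom m :=
  (Arrow.w s.a).symm.trans ((congrArg (· ≫ A.l.app m) s.a_left).trans (Category.id_comp _))

lemma isHom_iff {m n : Arrow C} (s : CoptStr A.comonad m) (t : CoptStr A.comonad n)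
    (φ : m ⟶ n) : s.IsHom t φ ↔ s.coact ≫ A.K.map φ = φ.right ≫ t.coact :=
  ⟨fun h => congrArg (fun φ => Arrow.Hom.right φ) h, fun h => Arrow.hom_ext _ _
    ((congrArg (· ≫ φ.left) s.a_left).trans ((Category.id_comp _).trans
      ((Category.comp_id _).symm.trans (congrArg (φ.left ≫ ·) t.a_left.symm)))) h⟩

/-- A coalgebra structure from its underlying map. -/
def ofCoact {m : Arrow C} (c : m.right ⟶ A.K.obj m) (h₁ : m.hom ≫ c = A.lHom m)
    (h₂ : c ≫ A.rHom m = 𝟙 _) : CoptStr A.comonad m where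
  a := Arrow.homMk (f := m) (g := A.L.obj m) (𝟙 _) c ((Category.id_comp _).trans h₁.symm)
  counit := Arrow.hom_ext _ _ (Category.comp_id _) h₂

end CoptStr

/-! ### Lifting coalgebras against algebras. -/

section Fill

variable {m g : Arrow C}

/-- The filler, of a square from a coalgebra to an algebra, given by the structures. -/
def fill (s : CoptStr A.comonad m) (t : AlgStr A.monad g) (φ : m ⟶ g) : m.right ⟶ g.left :=
  s.coact ≫ A.K.map φ ≫ t.act

lemma hom_fill (s : CoptStr A.comonad m) (t : AlgStr A.monad g) (φ : m ⟶ g) :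
    m.hom ≫ fill s t φ = φ.left := by
  rw [fill, reassoc_of% s.hom_coact, reassoc_of% A.lHom_K_map, t.lHom_act, Category.comp_id]

lemma fill_hom (s : CoptStr A.comonad m) (t : AlgStr A.monad g) (φ : m ⟶ g) :
    fill s t φ ≫ g.hom = φ.right := by
  rw [fill, Category.assoc, Category.assoc, t.act_hom, A.K_map_rHom, reassoc_of% s.coact_rHom]

/-- The coaction slides past `α`, the action past `β`, and functoriality of `K` handles the square
in between. All functoriality of lifts below is derived from this. -/
lemma fill_naturality {m' g' : Arrow C} {s : CoptStr A.comonad m} {t : AlgStr A.monad g}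
    {s' : CoptStr A.comonad m'} {t' : AlgStr A.monad g'} {φ : m ⟶ g} {φ' : m' ⟶ g'}
    {α : m ⟶ m'} {β : g ⟶ g'} (hα : s.IsHom s' α) (hβ : t.IsHom t' β)
    (h : φ ≫ β = α ≫ φ') : fill s t φ ≫ β.left = α.right ≫ fill s' t' φ' := by
  rw [CoptStr.isHom_iff] at hα
  rw [AlgStr.isHom_iff] at hβ
  rw [fill, fill, Category.assoc, Category.assoc, ← hβ, ← Category.assoc α.right, ← hα,
    Category.assoc, ← A.K.map_comp_assoc, ← A.K.map_comp_assoc, h]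

end Fill

section Free

/-- The free algebra structure on `R f`. -/
def freeAlg (A : Awfs C) (f : Arrow C) : AlgStr A.monad (Arrow.mk (A.rHom f)) :=
  ⟨A.mul.app f, A.left_unit f, (A.assoc f).symm⟩

lemma freeAlg_isHom (A : Awfs C) {f g : Arrow C} (φ : f ⟶ g) :
    (freeAlg A f).IsHom (freeAlg A g) (A.rMap φ) :=
  A.mul.naturality φ

/-- The cofree coalgebra structure on `L f`. -/
def cofreeCopt (A : Awfs C) (f : Arrow C) : CoptStr A.comonad (Arrow.mk (A.lHom f)) :=
  ⟨A.comul.app f, A.left_counit f⟩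

lemma cofreeCopt_isHom (A : Awfs C) {f g : Arrow C} (φ : f ⟶ g) :
    (cofreeCopt A f).IsHom (cofreeCopt A g) (A.lMap φ) :=
  (A.comul.naturality φ).symm

end Free

/-! ### Restriction, pullback and composition of algebras. -/

section Comparison

variable {B : Awfs C}

lemma AwfsHom.lHom_ξ (x : AwfsHom A B) (f : Arrow C) : A.lHom f ≫ x.ξ.app f = B.lHom f :=
  x.l_ξ f

lemma AwfsHom.ξ_rHom (x : AwfsHom A B) (f : Arrow C) : x.ξ.app f ≫ B.rHom f = A.rHom f :=
  x.ξ_r f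

/-- The square `R f ⟶ R' f` induced by a morphism of awfs's. -/
def AwfsHom.rSquare (x : AwfsHom A B) (f : Arrow C) :
    Arrow.mk (A.rHom f) ⟶ Arrow.mk (B.rHom f) :=
  Arrow.homMk' (x.ξ.app f) (𝟙 _) ((x.ξ_rHom f).trans (Category.comp_id _).symm)

lemma AwfsHom.π_ξ (x : AwfsHom A B) (f : Arrow C) :
    A.π f ≫ x.ξ.app f =
      A.K.map (x.rSquare f) ≫ x.ξ.app (Arrow.mk (B.rHom f)) ≫ B.π f :=
  congrArg (fun φ => Arrow.Hom.left φ) (x.mul_right f)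

/-- Restriction of algebra structures along a morphism of awfs's. -/
def AlgStr.restrict (x : AwfsHom A B) {f : Arrow C} (s : AlgStr B.monad f) :
    AlgStr A.monad f :=
  AlgStr.ofAct (x.ξ.app f ≫ s.act)
    (by rw [← Category.assoc, x.lHom_ξ, s.lHom_act])
    (by rw [Category.assoc, s.act_hom, x.ξ_rHom])
    (fun φ h₁ h₂ => by
      -- Compatibility of `ξ` with the multiplications turns `A.π` into `B.π`, which associativity
      -- of `s` replaces by a second action; naturality of `ξ` then brings it back to `A`.
      rw [← Category.assoc, x.π_ξ, Category.assoc, Category.assoc, s.π_act,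
        ← x.ξ.naturality_assoc, ← Category.assoc]
      rw [A.K_map_comp_eq' (χ := φ) h₁.symm ((Category.comp_id _).trans h₂.symm)])

lemma AlgStr.restrict_isHom (x : AwfsHom A B) {f g : Arrow C} {s : AlgStr B.monad f}
    {t : AlgStr B.monad g} {φ : f ⟶ g} (h : s.IsHom t φ) :
    (s.restrict x).IsHom (t.restrict x) φ := by
  rw [isHom_iff] at h ⊢
  rw [restrict, restrict, ofAct_act, ofAct_act, Category.assoc, ← h, x.ξ.naturality_assoc]

end Comparison

section Pullback

variable {f g : Arrow C}

/-- The pullback of an algebra structure. -/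
noncomputable def AlgStr.pullback (t : AlgStr A.monad g) (φ : f ⟶ g)
    (sq : IsPullback φ.left f.hom g.hom φ.right) : AlgStr A.monad f :=
  AlgStr.ofAct
    (sq.lift (A.K.map φ ≫ t.act) (A.rHom f)
      (by rw [Category.assoc, t.act_hom, A.K_map_rHom]))
    (sq.hom_ext
      (by rw [Category.assoc, sq.lift_fst, reassoc_of% A.lHom_K_map, t.lHom_act, Category.comp_id,
        Category.id_comp])
      (by rw [Category.assoc, sq.lift_snd, A.lHom_rHom, Category.id_comp]))
    (sq.lift_snd _ _ _)
    -- Associativity is tested on the two projections of the pullback: towards `g` it is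
    -- associativity of `t`, and towards the base of `f` both sides reduce to `R (R f)`.
    (fun ψ h₁ h₂ => sq.hom_ext
      (by
        rw [Category.assoc (A.π f), Category.assoc (A.K.map ψ), sq.lift_fst, reassoc_of% A.π_naturality, t.π_act,
          ← Category.assoc, ← Category.assoc]
        refine congrArg (· ≫ t.act) (A.K_map_comp_eq ?_ ?_)
        · rw [h₁, sq.lift_fst]; rfl
        · rw [h₂]; exact (Category.comp_id _).trans (Category.id_comp _).symm)
      (by
        rw [Category.assoc (A.π f), Category.assoc (A.K.map ψ), sq.lift_snd, A.π_rHom, A.K_map_rHom, h₂,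
          Category.comp_id]))

lemma AlgStr.pullback_isHom (t : AlgStr A.monad g) (φ : f ⟶ g)
    (sq : IsPullback φ.left f.hom g.hom φ.right) : (t.pullback φ sq).IsHom t φ := by
  rw [isHom_iff]
  exact (sq.lift_fst _ _ _).symm

/-- Squares into pulled back algebras are morphisms as soon as their composites with the
pullback square are. -/
lemma AlgStr.isHom_pullback (t : AlgStr A.monad g) (φ : f ⟶ g)
    (sq : IsPullback φ.left f.hom g.hom φ.right) {e : Arrow C} {s : AlgStr A.monad e}
    {ψ : e ⟶ f} (h : s.IsHom t (ψ ≫ φ)) : s.IsHom (t.pullback φ sq) ψ := by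
  have h' := (isHom_iff _ _ _).1 (t.pullback_isHom φ sq)
  rw [isHom_iff] at h ⊢
  refine sq.hom_ext ?_ ?_
  · rw [Category.assoc, Category.assoc, ← h', ← A.K.map_comp_assoc, h]
    rfl
  · rw [Category.assoc, act_hom, Category.assoc, Arrow.w, reassoc_of% s.act_hom, A.K_map_rHom]

/-- A morphism of pullback squares of algebras. -/
lemma AlgStr.pullback_map_isHom {f' g' : Arrow C} (t : AlgStr A.monad g) (φ : f ⟶ g)
    (sq : IsPullback φ.left f.hom g.hom φ.right) (t' : AlgStr A.monad g') (φ' : f' ⟶ g')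
    (sq' : IsPullback φ'.left f'.hom g'.hom φ'.right) {α : f ⟶ f'} {β : g ⟶ g'}
    (h : t.IsHom t' β) (w : φ ≫ β = α ≫ φ') :
    (t.pullback φ sq).IsHom (t'.pullback φ' sq') α :=
  t'.isHom_pullback φ' sq' (w ▸ (t.pullback_isHom φ sq).comp h)

end Pullback

section Composition

variable {X Y Z : C} {g : X ⟶ Y} {h : Y ⟶ Z}

/-- The map `K (g ≫ h) ⟶ Y` induced by an algebra structure on `h`. -/
def AlgStr.compMiddle (g : X ⟶ Y) (t : AlgStr A.monad (Arrow.mk h)) :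
    A.K.obj (Arrow.mk (g ≫ h)) ⟶ Y :=
  A.K.map (Arrow.homMk' g (𝟙 Z) (Category.comp_id _).symm) ≫ t.act

lemma AlgStr.lHom_compMiddle (g : X ⟶ Y) (t : AlgStr A.monad (Arrow.mk h)) :
    A.lHom (Arrow.mk (g ≫ h)) ≫ t.compMiddle g = g := by
  rw [compMiddle, reassoc_of% A.lHom_K_map, t.lHom_act]
  exact Category.comp_id _

lemma AlgStr.compMiddle_hom (g : X ⟶ Y) (t : AlgStr A.monad (Arrow.mk h)) :
    t.compMiddle g ≫ h = A.rHom (Arrow.mk (g ≫ h)) := by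
  rw [compMiddle, Category.assoc]
  refine (congrArg (_ ≫ ·) t.act_hom).trans ?_
  rw [A.K_map_rHom]
  exact Category.comp_id _

/-- The square `L (g ≫ h) ⟶ g` induced by an algebra structure on `h`. -/
def AlgStr.compSquare (g : X ⟶ Y) (t : AlgStr A.monad (Arrow.mk h)) :
    Arrow.mk (A.lHom (Arrow.mk (g ≫ h))) ⟶ Arrow.mk g :=
  Arrow.homMk' (𝟙 X) (t.compMiddle g) ((Category.id_comp _).trans (t.lHom_compMiddle g).symm)

/-- The structure map `K (g ≫ h) ⟶ X` of a composite of algebras. -/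
def AlgStr.compAct (s : AlgStr A.monad (Arrow.mk g)) (t : AlgStr A.monad (Arrow.mk h)) :
    A.K.obj (Arrow.mk (g ≫ h)) ⟶ X :=
  A.σ (Arrow.mk (g ≫ h)) ≫ A.K.map (t.compSquare g) ≫ s.act

/-- The composite action lifts in two stages: `t` gives `compMiddle`, and `compAct` is then the
filler of `compSquare` for the cofree coalgebra `L (g ≫ h)`. It therefore lies over the first stage.
-/
lemma AlgStr.compAct_hom (s : AlgStr A.monad (Arrow.mk g)) (t : AlgStr A.monad (Arrow.mk h)) :
    s.compAct t ≫ g = t.compMiddle g := by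
  rw [compAct, Category.assoc, Category.assoc]
  refine (congrArg (fun x => A.σ (Arrow.mk (g ≫ h)) ≫ A.K.map (t.compSquare g) ≫ x)
    s.act_hom).trans ?_
  rw [A.K_map_rHom, reassoc_of% A.σ_rHom]
  rfl

lemma AlgStr.π_compMiddle (g : X ⟶ Y) (t : AlgStr A.monad (Arrow.mk h))
    (φ : Arrow.mk (A.rHom (Arrow.mk (g ≫ h))) ⟶ Arrow.mk h)
    (h₁ : φ.left = t.compMiddle g) (h₂ : φ.right = 𝟙 Z) :
    A.π (Arrow.mk (g ≫ h)) ≫ t.compMiddle g = A.K.map φ ≫ t.act := by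
  rw [compMiddle, reassoc_of% A.π_naturality, t.π_act, reassoc_of% A.K_map_comp_eq' (χ := φ)]
  · exact h₁.symm
  · exact (Category.comp_id _).trans h₂.symm

/-- The distributive law moves `π` past `σ`. After that, associativity of `s` treats the upper stage
and associativity of `t` the lower one. -/
lemma AlgStr.π_compAct (s : AlgStr A.monad (Arrow.mk g)) (t : AlgStr A.monad (Arrow.mk h))
    (φ : Arrow.mk (A.rHom (Arrow.mk (g ≫ h))) ⟶ Arrow.mk (g ≫ h))
    (h₁ : φ.left = s.compAct t) (h₂ : φ.right = 𝟙 Z) :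
    A.π (Arrow.mk (g ≫ h)) ≫ s.compAct t = A.K.map φ ≫ s.compAct t := by
  rw [compAct, reassoc_of% A.π_σ, reassoc_of% A.π_naturality, s.π_act, reassoc_of% A.σ_naturality]
  refine congrArg (A.σ (Arrow.mk (A.rHom (Arrow.mk (g ≫ h)))) ≫ ·) ?_
  -- The lower stage: since `compAct` lies over `compMiddle`, this is associativity of `t`.
  have key : A.K.map φ ≫ t.compMiddle g = A.π (Arrow.mk (g ≫ h)) ≫ t.compMiddle g := by
    rw [t.π_compMiddle g (φ ≫ Arrow.homMk' g (𝟙 Z) (Category.comp_id _).symm), A.K.map_comp,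
      Category.assoc]
    · rfl
    · exact (congrArg (· ≫ g) h₁).trans (s.compAct_hom t)
    · exact (Category.comp_id _).trans h₂
  -- Both sides are `K` of a square `L (R (g ≫ h)) ⟶ g`; the squares agree on domains by `h₁` and on
  -- codomains by `key`.
  have h₃ : A.K.map (A.canonicalSquare (Arrow.mk (g ≫ h))) ≫
      A.K.map (A.rMap (t.compSquare g)) ≫ A.K.map s.actSquare =
      A.K.map (A.lMap φ) ≫ A.K.map (t.compSquare g) := by
    rw [← A.K.map_comp, ← A.K.map_comp, ← A.K.map_comp]
    refine congrArg A.K.map (Arrow.hom_ext _ _ ?_ ?_)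
    · exact h₁.symm.trans (Category.comp_id _).symm
    · exact (congrArg (_ ≫ ·) (Category.comp_id _)).trans key.symm
  rw [reassoc_of% h₃]

/-- The composite of two algebras. -/
def AlgStr.comp (s : AlgStr A.monad (Arrow.mk g)) (t : AlgStr A.monad (Arrow.mk h)) :
    AlgStr A.monad (Arrow.mk (g ≫ h)) :=
  AlgStr.ofAct (s.compAct t)
    (by
      rw [compAct, reassoc_of% A.lHom_σ, reassoc_of% A.lHom_K_map, s.lHom_act]
      exact Category.comp_id _)
    (by
      refine Eq.trans ?_ (t.compMiddle_hom g)
      rw [← s.compAct_hom t, Category.assoc]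
      rfl)
    (fun φ h₁ h₂ => s.π_compAct t φ h₁ h₂)

/-- Compatibility of `t` with `β` makes the intermediate lifts commute; naturality of `σ` and
compatibility of `s` with `α` do the rest. The squares are tied together only through their sides,
so that `γ` may be any convenient presentation of the outer square. -/
lemma AlgStr.comp_isHom {X' Y' Z' : C} {g' : X' ⟶ Y'} {h' : Y' ⟶ Z'}
    {s : AlgStr A.monad (Arrow.mk g)} {t : AlgStr A.monad (Arrow.mk h)}
    {s' : AlgStr A.monad (Arrow.mk g')} {t' : AlgStr A.monad (Arrow.mk h')}
    {α : Arrow.mk g ⟶ Arrow.mk g'} {β : Arrow.mk h ⟶ Arrow.mk h'}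
    {γ : Arrow.mk (g ≫ h) ⟶ Arrow.mk (g' ≫ h')}
    (hα : s.IsHom s' α) (hβ : t.IsHom t' β) (h₁ : α.right = β.left) (h₂ : γ.left = α.left)
    (h₃ : γ.right = β.right) : (s.comp t).IsHom (s'.comp t') γ := by
  rw [isHom_iff] at hα hβ ⊢
  have key : A.K.map γ ≫ t'.compMiddle g' = t.compMiddle g ≫ α.right := by
    rw [compMiddle, compMiddle, h₁, Category.assoc]
    refine Eq.trans ?_ (congrArg (_ ≫ ·) hβ)
    rw [← Category.assoc, ← Category.assoc]
    refine congrArg (· ≫ t'.act) (A.K_map_comp_eq ?_ ?_)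
    · have := Arrow.w α
      change γ.left ≫ g' = g ≫ β.left
      rw [h₂, ← h₁]; exact this
    · exact (Category.comp_id _).trans (h₃.trans (Category.id_comp _).symm)
  change A.K.map γ ≫ s'.compAct t' = s.compAct t ≫ γ.left
  rw [compAct, compAct, h₂, Category.assoc, Category.assoc, reassoc_of% A.σ_naturality]
  refine congrArg (_ ≫ ·) ?_
  refine Eq.trans ?_ (congrArg (_ ≫ ·) hα)
  rw [← Category.assoc, ← Category.assoc]
  refine congrArg (· ≫ s'.act) (A.K_map_comp_eq ?_ key)
  exact (Category.comp_id _).trans (h₂.trans (Category.id_comp _).symm)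

end Composition

end AwfsAlgebra

/-! ### Maps out of the pushout product with the boundary of the interval. -/

noncomputable section BoundaryPushoutProduct

variable {C : Type u} [Category.{v} C] [SemiCartesianMonoidalCategory C]

lemma whiskerRight_fst {X Y : C} (f : X ⟶ Y) (Z : C) : f ▷ Z ≫ fst Y Z = fst X Z ≫ f := by
  rw [fst_def, fst_def, ← whisker_exchange_assoc, Category.assoc, rightUnitor_naturality]

/-- Affineness enters here: a point of `I` followed by the map to the terminal unit is the identity.
-/
lemma rightUnitor_inv_whiskerLeft_fst (X : C) {I : C} (d : 𝟙_ C ⟶ I) :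
    (ρ_ X).inv ≫ X ◁ d ≫ fst X I = 𝟙 X := by
  have h : d ≫ isTerminalTensorUnit.from I = 𝟙 _ := isTerminalTensorUnit.hom_ext _ _
  rw [fst_def, ← MonoidalCategory.whiskerLeft_comp_assoc, h]
  simp

variable [HasFiniteColimits C]

section TensorCoprod

variable (X : C)

/-- The copairing `X ⊗ (1 + 1) ⟶ Z`. -/
def tensorCoprodDesc [PreservesFiniteColimits (tensorLeft X)] {Z : C} (u₀ u₁ : X ⟶ Z) :
    X ⊗ ((𝟙_ C) ⨿ (𝟙_ C)) ⟶ Z :=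
  (PreservesColimitPair.iso (tensorLeft X) (𝟙_ C) (𝟙_ C)).inv ≫
    coprod.desc ((ρ_ X).hom ≫ u₀) ((ρ_ X).hom ≫ u₁)

lemma whiskerLeft_inl_tensorCoprodDesc [PreservesFiniteColimits (tensorLeft X)] {Z : C}
    (u₀ u₁ : X ⟶ Z) :
    X ◁ coprod.inl ≫ tensorCoprodDesc X u₀ u₁ = (ρ_ X).hom ≫ u₀ := by
  have h : coprod.inl ≫ (PreservesColimitPair.iso (tensorLeft X) (𝟙_ C) (𝟙_ C)).hom =
      X ◁ coprod.inl := by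
    rw [PreservesColimitPair.iso_hom]; exact coprod.inl_desc _ _
  rw [tensorCoprodDesc, ← h, Category.assoc, Iso.hom_inv_id_assoc]
  exact coprod.inl_desc _ _

lemma whiskerLeft_inr_tensorCoprodDesc [PreservesFiniteColimits (tensorLeft X)] {Z : C}
    (u₀ u₁ : X ⟶ Z) :
    X ◁ coprod.inr ≫ tensorCoprodDesc X u₀ u₁ = (ρ_ X).hom ≫ u₁ := by
  have h : coprod.inr ≫ (PreservesColimitPair.iso (tensorLeft X) (𝟙_ C) (𝟙_ C)).hom =
      X ◁ coprod.inr := by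
    rw [PreservesColimitPair.iso_hom]; exact coprod.inr_desc _ _
  rw [tensorCoprodDesc, ← h, Category.assoc, Iso.hom_inv_id_assoc]
  exact coprod.inr_desc _ _

variable {X} in
-- As `X ⊗ -` preserves the coproduct, the two whiskered inclusions are jointly epimorphic.
lemma tensorCoprod_hom_ext [PreservesFiniteColimits (tensorLeft X)] {Z : C}
    {a b : X ⊗ ((𝟙_ C) ⨿ (𝟙_ C)) ⟶ Z} (h₁ : X ◁ coprod.inl ≫ a = X ◁ coprod.inl ≫ b)
    (h₂ : X ◁ coprod.inr ≫ a = X ◁ coprod.inr ≫ b) : a = b := by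
  rw [← cancel_epi (PreservesColimitPair.iso (tensorLeft X) (𝟙_ C) (𝟙_ C)).hom,
    PreservesColimitPair.iso_hom]
  refine coprod.hom_ext ?_ ?_
  · have h : coprod.inl ≫ coprodComparison (tensorLeft X) (𝟙_ C) (𝟙_ C) = X ◁ coprod.inl :=
      coprod.inl_desc _ _
    exact ((reassoc_of% h) a).trans (h₁.trans ((reassoc_of% h) b).symm)
  · have h : coprod.inr ≫ coprodComparison (tensorLeft X) (𝟙_ C) (𝟙_ C) = X ◁ coprod.inr :=
      coprod.inr_desc _ _
    exact ((reassoc_of% h) a).trans (h₂.trans ((reassoc_of% h) b).symm)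

end TensorCoprod

variable (J : Interval C)

/-- The pushout product with the boundary inclusion of the interval. -/
abbrev boundaryProduct : Arrow C ⥤ Arrow C :=
  Arrow.pushoutProduct.flip.obj (Arrow.mk J.boundary)

variable {J}

section

variable (m : Arrow C)

/-- The inclusion `B ⊗ (1 + 1) ⟶ B ⊗ (1 + 1) + A ⊗ I`. -/
def boundaryInl : m.right ⊗ ((𝟙_ C) ⨿ (𝟙_ C)) ⟶ ((boundaryProduct J).obj m).left :=
  pushout.inl _ _

/-- The inclusion `A ⊗ I ⟶ B ⊗ (1 + 1) + A ⊗ I`. -/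
def boundaryInr : m.left ⊗ J.I ⟶ ((boundaryProduct J).obj m).left :=
  pushout.inr _ _

/-- The pushout product `m □ [δ₀, δ₁]`, with codomain `B ⊗ I`. -/
def boundaryι : ((boundaryProduct J).obj m).left ⟶ m.right ⊗ J.I :=
  ((boundaryProduct J).obj m).hom

lemma boundaryInl_ι : boundaryInl m ≫ boundaryι m = m.right ◁ J.boundary :=
  pushout.inl_desc _ _ _

lemma boundaryInr_ι : boundaryInr m ≫ boundaryι m = m.hom ▷ J.I :=
  pushout.inr_desc _ _ _

variable {m} in
lemma boundaryProduct_hom_ext (hcolim : ∀ X : C, PreservesFiniteColimits (tensorLeft X))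
    {Z : C} {a b : ((boundaryProduct J).obj m).left ⟶ Z}
    (h₀ : m.right ◁ coprod.inl ≫ boundaryInl m ≫ a = m.right ◁ coprod.inl ≫ boundaryInl m ≫ b)
    (h₁ : m.right ◁ coprod.inr ≫ boundaryInl m ≫ a = m.right ◁ coprod.inr ≫ boundaryInl m ≫ b)
    (h₂ : boundaryInr m ≫ a = boundaryInr m ≫ b) : a = b :=
  pushout.hom_ext (tensorCoprod_hom_ext h₀ h₁) h₂

/-- The map out of the domain of `m □ [δ₀, δ₁]` given by its restrictions to the endpoints and
to `A ⊗ I`. -/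
def boundaryDesc (hcolim : ∀ X : C, PreservesFiniteColimits (tensorLeft X)) {Z : C}
    (u₀ u₁ : m.right ⟶ Z) (w : m.left ⊗ J.I ⟶ Z)
    (h₀ : (ρ_ m.left).inv ≫ m.left ◁ J.δ₀ ≫ w = m.hom ≫ u₀)
    (h₁ : (ρ_ m.left).inv ≫ m.left ◁ J.δ₁ ≫ w = m.hom ≫ u₁) :
    ((boundaryProduct J).obj m).left ⟶ Z :=
  pushout.desc (tensorCoprodDesc m.right u₀ u₁) w (by
    change m.hom ▷ _ ≫ _ = m.left ◁ J.boundary ≫ w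
    -- Agreement on `A ⊗ (1 + 1)` is tested at each endpoint, where it is `h₀` or `h₁`.
    refine tensorCoprod_hom_ext ?_ ?_
    · rw [whisker_exchange_assoc, whiskerLeft_inl_tensorCoprodDesc, rightUnitor_naturality_assoc,
        ← h₀, Iso.hom_inv_id_assoc, ← MonoidalCategory.whiskerLeft_comp_assoc, Interval.boundary,
        coprod.inl_desc]
    · rw [whisker_exchange_assoc, whiskerLeft_inr_tensorCoprodDesc, rightUnitor_naturality_assoc,
        ← h₁, Iso.hom_inv_id_assoc, ← MonoidalCategory.whiskerLeft_comp_assoc, Interval.boundary,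
        coprod.inr_desc])

variable (hcolim : ∀ X : C, PreservesFiniteColimits (tensorLeft X)) {Z : C}
  (u₀ u₁ : m.right ⟶ Z) (w : m.left ⊗ J.I ⟶ Z)
  (h₀ : (ρ_ m.left).inv ≫ m.left ◁ J.δ₀ ≫ w = m.hom ≫ u₀)
  (h₁ : (ρ_ m.left).inv ≫ m.left ◁ J.δ₁ ≫ w = m.hom ≫ u₁)

lemma boundaryInl_desc : boundaryInl m ≫ boundaryDesc m hcolim u₀ u₁ w h₀ h₁ =
    tensorCoprodDesc m.right u₀ u₁ := pushout.inl_desc _ _ _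

lemma boundaryInr_desc : boundaryInr m ≫ boundaryDesc m hcolim u₀ u₁ w h₀ h₁ = w :=
  pushout.inr_desc _ _ _

lemma whiskerLeft_boundaryInl_desc_zero :
    m.right ◁ coprod.inl ≫ boundaryInl m ≫ boundaryDesc m hcolim u₀ u₁ w h₀ h₁ =
      (ρ_ m.right).hom ≫ u₀ := by
  rw [boundaryInl_desc, whiskerLeft_inl_tensorCoprodDesc]

lemma whiskerLeft_boundaryInl_desc_one :
    m.right ◁ coprod.inr ≫ boundaryInl m ≫ boundaryDesc m hcolim u₀ u₁ w h₀ h₁ =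
      (ρ_ m.right).hom ≫ u₁ := by
  rw [boundaryInl_desc, whiskerLeft_inr_tensorCoprodDesc]

end

lemma whiskerLeft_inl_boundary (X : C) :
    X ◁ coprod.inl ≫ X ◁ J.boundary = X ◁ J.δ₀ := by
  rw [← MonoidalCategory.whiskerLeft_comp, Interval.boundary, coprod.inl_desc]

lemma whiskerLeft_inr_boundary (X : C) :
    X ◁ coprod.inr ≫ X ◁ J.boundary = X ◁ J.δ₁ := by
  rw [← MonoidalCategory.whiskerLeft_comp, Interval.boundary, coprod.inr_desc]

lemma boundaryInl_map {m n : Arrow C} (φ : m ⟶ n) :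
    boundaryInl m ≫ ((boundaryProduct J).map φ).left = φ.right ▷ _ ≫ boundaryInl n :=
  IsPushout.inl_desc _ _ _ _

lemma boundaryInr_map {m n : Arrow C} (φ : m ⟶ n) :
    boundaryInr m ≫ ((boundaryProduct J).map φ).left = φ.left ▷ J.I ≫ boundaryInr n :=
  IsPushout.inr_desc _ _ _ _

end BoundaryPushoutProduct

/-! ### Paths, transposed homotopies and coordinates on pullback homs. -/

noncomputable section PathSpace

variable {C : Type u} [Category.{v} C] [SemiCartesianMonoidalCategory C] {J : Interval C}
  {P : C ⥤ C} (adj : tensorRight J.I ⊣ P)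

/-- The transpose of a homotopy. -/
def transpose {X Y : C} (h : X ⊗ J.I ⟶ Y) : X ⟶ P.obj Y := adj.homEquiv X Y h

lemma transpose_evalHom {X Y : C} (h : X ⊗ J.I ⟶ Y) (d : 𝟙_ C ⟶ J.I) :
    transpose adj h ≫ evalHom adj d Y = (ρ_ X).inv ≫ X ◁ d ≫ h := by
  have e : transpose adj h ▷ J.I ≫ adj.counit.app Y = h :=
    (adj.homEquiv_counit (X := X) (g := transpose adj h)).symm.trans
      ((adj.homEquiv X Y).symm_apply_apply h)
  rw [evalHom, rightUnitor_inv_naturality_assoc, ← whisker_exchange_assoc, e]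

lemma comp_transpose {X X' Y : C} (k : X' ⟶ X) (h : X ⊗ J.I ⟶ Y) :
    k ≫ transpose adj h = transpose adj (k ▷ J.I ≫ h) :=
  (adj.homEquiv_naturality_left k h).symm

lemma transpose_map {X Y Y' : C} (h : X ⊗ J.I ⟶ Y) (k : Y ⟶ Y') :
    transpose adj h ≫ P.map k = transpose adj (h ≫ k) :=
  (adj.homEquiv_naturality_right h k).symm

lemma transpose_fst_comp {X Y : C} (k : X ⟶ Y) :
    transpose adj (fst X J.I ≫ k) = k ≫ constHom adj Y := by
  rw [constHom_naturality, ← transpose_map]; rfl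

variable [HasFiniteLimits C]

section EndpointHom

variable (d : 𝟙_ C ⟶ J.I) (f : Arrow C)

/-- The projection to `X` from the codomain of the pullback hom with an endpoint. -/
def endpointHomFst : ((endpointHom adj d).obj f).right ⟶ f.left :=
  pullback.fst ((𝟭 C).map f.hom) ((evalAt adj d).app f.right)

/-- The projection to `P Y` from the codomain of the pullback hom with an endpoint. -/
def endpointHomSnd : ((endpointHom adj d).obj f).right ⟶ P.obj f.right :=
  pullback.snd ((𝟭 C).map f.hom) ((evalAt adj d).app f.right)

/-- The map to the codomain of the pullback hom with an endpoint with given projections. -/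
def endpointHomLift {W : C} (a : W ⟶ f.left) (b : W ⟶ P.obj f.right)
    (w : a ≫ f.hom = b ≫ evalHom adj d f.right) : W ⟶ ((endpointHom adj d).obj f).right :=
  pullback.lift (f := (𝟭 C).map f.hom) (g := (evalAt adj d).app f.right) a b w

/-- The pullback hom of `f : X ⟶ Y` with an endpoint, with domain `P X`. -/
def endpointHomHom : P.obj f.left ⟶ ((endpointHom adj d).obj f).right :=
  ((endpointHom adj d).obj f).hom

lemma endpointHomLift_fst {W : C} (a : W ⟶ f.left) (b : W ⟶ P.obj f.right)
    (w : a ≫ f.hom = b ≫ evalHom adj d f.right) :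
    endpointHomLift adj d f a b w ≫ endpointHomFst adj d f = a := pullback.lift_fst _ _ _

lemma endpointHomLift_snd {W : C} (a : W ⟶ f.left) (b : W ⟶ P.obj f.right)
    (w : a ≫ f.hom = b ≫ evalHom adj d f.right) :
    endpointHomLift adj d f a b w ≫ endpointHomSnd adj d f = b := pullback.lift_snd _ _ _

lemma endpointHomHom_fst :
    endpointHomHom adj d f ≫ endpointHomFst adj d f = evalHom adj d f.left :=
  pullback.lift_fst _ _ _

lemma endpointHomHom_snd : endpointHomHom adj d f ≫ endpointHomSnd adj d f = P.map f.hom :=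
  pullback.lift_snd _ _ _

variable {adj d f} in
lemma endpointHom_hom_ext {W : C} {a b : W ⟶ ((endpointHom adj d).obj f).right}
    (h₁ : a ≫ endpointHomFst adj d f = b ≫ endpointHomFst adj d f)
    (h₂ : a ≫ endpointHomSnd adj d f = b ≫ endpointHomSnd adj d f) : a = b :=
  pullback.hom_ext h₁ h₂

variable {f} {g : Arrow C} (φ : f ⟶ g)

lemma endpointHom_map_right_fst :
    ((endpointHom adj d).map φ).right ≫ endpointHomFst adj d g =
      endpointHomFst adj d f ≫ φ.left :=
  pullback.lift_fst _ _ _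

lemma endpointHom_map_right_snd :
    ((endpointHom adj d).map φ).right ≫ endpointHomSnd adj d g =
      endpointHomSnd adj d f ≫ P.map φ.right :=
  pullback.lift_snd _ _ _

end EndpointHom

section BoundaryHom

variable (f : Arrow C)

/-- The projection to `X × X` from the codomain of the pullback hom with the boundary. -/
def boundaryHomFst : ((boundaryHom adj).obj f).right ⟶ f.left ⨯ f.left :=
  pullback.fst ((square C).map f.hom) ((endpoints adj).app f.right)

/-- The projection to `P Y` from the codomain of the pullback hom with the boundary. -/
def boundaryHomSnd : ((boundaryHom adj).obj f).right ⟶ P.obj f.right :=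
  pullback.snd ((square C).map f.hom) ((endpoints adj).app f.right)

/-- The map to the codomain of the pullback hom with the boundary with given projections. -/
def boundaryHomLift {W : C} (a₀ a₁ : W ⟶ f.left) (b : W ⟶ P.obj f.right)
    (w₀ : a₀ ≫ f.hom = b ≫ evalHom adj J.δ₀ f.right)
    (w₁ : a₁ ≫ f.hom = b ≫ evalHom adj J.δ₁ f.right) : W ⟶ ((boundaryHom adj).obj f).right :=
  pullback.lift (f := (square C).map f.hom) (g := (endpoints adj).app f.right)
    (prod.lift a₀ a₁) b (by
      change prod.lift a₀ a₁ ≫ Limits.prod.map f.hom f.hom = b ≫ prod.lift _ _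
      rw [prod.lift_map, prod.comp_lift, w₀, w₁])

/-- The pullback hom of `f : X ⟶ Y` with the boundary, with domain `P X`. -/
def boundaryHomHom : P.obj f.left ⟶ ((boundaryHom adj).obj f).right :=
  ((boundaryHom adj).obj f).hom

lemma boundaryHomHom_fst : boundaryHomHom adj f ≫ boundaryHomFst adj f =
    prod.lift (evalHom adj J.δ₀ f.left) (evalHom adj J.δ₁ f.left) :=
  pullback.lift_fst _ _ _

lemma boundaryHomHom_snd : boundaryHomHom adj f ≫ boundaryHomSnd adj f = P.map f.hom :=
  pullback.lift_snd _ _ _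

section

variable {f} {W : C} (a₀ a₁ : W ⟶ f.left) (b : W ⟶ P.obj f.right)
    (w₀ : a₀ ≫ f.hom = b ≫ evalHom adj J.δ₀ f.right)
    (w₁ : a₁ ≫ f.hom = b ≫ evalHom adj J.δ₁ f.right)

lemma boundaryHomLift_fst :
    boundaryHomLift adj f a₀ a₁ b w₀ w₁ ≫ boundaryHomFst adj f = prod.lift a₀ a₁ :=
  pullback.lift_fst _ _ _

lemma boundaryHomLift_snd :
    boundaryHomLift adj f a₀ a₁ b w₀ w₁ ≫ boundaryHomSnd adj f = b :=
  pullback.lift_snd _ _ _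

end

variable {adj f} in
lemma boundaryHom_hom_ext {W : C} {a b : W ⟶ ((boundaryHom adj).obj f).right}
    (h₁ : a ≫ boundaryHomFst adj f = b ≫ boundaryHomFst adj f)
    (h₂ : a ≫ boundaryHomSnd adj f = b ≫ boundaryHomSnd adj f) : a = b :=
  pullback.hom_ext h₁ h₂

variable {f} {g : Arrow C} (φ : f ⟶ g)

lemma boundaryHom_map_right_fst : ((boundaryHom adj).map φ).right ≫ boundaryHomFst adj g =
    boundaryHomFst adj f ≫ Limits.prod.map φ.left φ.left :=
  pullback.lift_fst _ _ _

lemma boundaryHom_map_right_snd : ((boundaryHom adj).map φ).right ≫ boundaryHomSnd adj g =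
    boundaryHomSnd adj f ≫ P.map φ.right :=
  pullback.lift_snd _ _ _

end BoundaryHom

/-! ### Lifting strong deformation retracts against fibrations. -/

section StrongDeformationRetract

variable {A : Awfs C} {m g : Arrow C} (s : CoptStr A.comonad m)
  (d : StrongDeformationRetract J m.hom)
  (t : AlgStr A.monad ((endpointHom adj J.δ₀).obj g)) (φ : m ⟶ g)

/-- The bottom map of `sdrSquare`. -/
def sdrRight : m.right ⟶ ((endpointHom adj J.δ₀).obj g).right :=
  endpointHomLift adj J.δ₀ g (d.f ≫ φ.left) (transpose adj (d.homotopy.h ≫ φ.right)) (by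
    -- The homotopy starts at the retraction followed by `m`, so its image in the base starts below
    -- `d.f ≫ φ.left`.
    have h : (ρ_ m.right).inv ≫ m.right ◁ J.δ₀ ≫ d.homotopy.h ≫ φ.right =
        (d.f ≫ m.hom) ≫ φ.right := by
      refine Eq.trans ?_ (congrArg (· ≫ φ.right) d.homotopy.left)
      simp only [Category.assoc]
    rw [transpose_evalHom, h, Category.assoc, Category.assoc, Arrow.w])

lemma sdrRight_fst : sdrRight adj d φ ≫ endpointHomFst adj J.δ₀ g = d.f ≫ φ.left :=
  endpointHomLift_fst _ _ _ _ _ _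

lemma sdrRight_snd : sdrRight adj d φ ≫ endpointHomSnd adj J.δ₀ g =
    transpose adj (d.homotopy.h ≫ φ.right) :=
  endpointHomLift_snd _ _ _ _ _ _

/-- The homotopy is constant on the subobject `m`, so the constant paths on `φ.left` lift its
restriction. Prescribing them is what makes the final filler extend `φ.left`. -/
lemma hom_sdrRight : (φ.left ≫ constHom adj g.left) ≫ endpointHomHom adj J.δ₀ g =
    m.hom ≫ sdrRight adj d φ := by
  refine endpointHom_hom_ext ?_ ?_
  · rw [Category.assoc, Category.assoc, Category.assoc, endpointHomHom_fst, sdrRight_fst,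
      reassoc_of% d.section_retraction, constHom_evalHom, Category.comp_id]
  · rw [Category.assoc, Category.assoc, Category.assoc, endpointHomHom_snd, sdrRight_snd,
      comp_transpose, reassoc_of% d.constant, ← Arrow.w φ, ← constHom_naturality,
      transpose_fst_comp, Category.assoc]

/-- The lifting problem against the pullback hom with `δ₀` given by a square out of a strong
deformation retract. -/
def sdrSquare : m ⟶ (endpointHom adj J.δ₀).obj g :=
  Arrow.homMk (φ.left ≫ constHom adj g.left) (sdrRight adj d φ) (hom_sdrRight adj d φ)

/-- The family of paths filling the lifting problem `sdrSquare`. -/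
def sdrPathFill : m.right ⟶ P.obj g.left := fill s t (sdrSquare adj d φ)

lemma hom_sdrPathFill : m.hom ≫ sdrPathFill adj s d t φ = φ.left ≫ constHom adj g.left :=
  hom_fill s t (sdrSquare adj d φ)

lemma sdrPathFill_map : sdrPathFill adj s d t φ ≫ P.map g.hom =
    transpose adj (d.homotopy.h ≫ φ.right) := by
  rw [← endpointHomHom_snd adj J.δ₀]
  exact (Category.assoc _ _ _).symm.trans
    ((congrArg (· ≫ _) (fill_hom s t _)).trans (sdrRight_snd adj d φ))

lemma sdrPathFill_naturality {m' g' : Arrow C} {s' : CoptStr A.comonad m'}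
    {d' : StrongDeformationRetract J m'.hom}
    {t' : AlgStr A.monad ((endpointHom adj J.δ₀).obj g')} {φ' : m' ⟶ g'}
    {α : m ⟶ m'} {β : g ⟶ g'} (hs : s.IsHom s' α) (hd : d.IsHom d' α.right α.left)
    (ht : t.IsHom t' ((endpointHom adj J.δ₀).map β)) (w : φ ≫ β = α ≫ φ') :
    sdrPathFill adj s d t φ ≫ P.map β.left = α.right ≫ sdrPathFill adj s' d' t' φ' := by
  have w₁ : φ.left ≫ β.left = α.left ≫ φ'.left := congrArg (fun x => Arrow.Hom.left x) w
  have w₂ : φ.right ≫ β.right = α.right ≫ φ'.right := congrArg (fun x => Arrow.Hom.right x) w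
  refine fill_naturality hs ht (φ := sdrSquare adj d φ) (φ' := sdrSquare adj d' φ') ?_
  refine Arrow.hom_ext _ _ ?_ ?_
  · change (φ.left ≫ constHom adj g.left) ≫ P.map β.left =
      α.left ≫ φ'.left ≫ constHom adj g'.left
    rw [Category.assoc, ← constHom_naturality, reassoc_of% w₁]
  · change sdrRight adj d φ ≫ ((endpointHom adj J.δ₀).map β).right = α.right ≫ sdrRight adj d' φ'
    refine endpointHom_hom_ext ?_ ?_
    · rw [Category.assoc, Category.assoc, sdrRight_fst, endpointHom_map_right_fst,
        reassoc_of% sdrRight_fst, ← reassoc_of% hd.retraction, w₁]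
    · rw [Category.assoc, Category.assoc, sdrRight_snd, endpointHom_map_right_snd,
        reassoc_of% sdrRight_snd, transpose_map, comp_transpose, reassoc_of% hd.homotopy, ← w₂,
        Category.assoc]

/-- The filler, of a square from a strong deformation retract with a cofibration structure to a
fibration. -/
def sdrFill : m.right ⟶ g.left := sdrPathFill adj s d t φ ≫ evalHom adj J.δ₁ g.left

/-- The lifted paths are constant along `m`, so their value at `δ₁` is still `φ.left`. -/
lemma hom_sdrFill : m.hom ≫ sdrFill adj s d t φ = φ.left := by
  rw [sdrFill, ← Category.assoc, hom_sdrPathFill, Category.assoc, constHom_evalHom,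
    Category.comp_id]

/-- The lifted paths lie over the image of the homotopy, which ends at the identity. -/
lemma sdrFill_hom : sdrFill adj s d t φ ≫ g.hom = φ.right := by
  have e : (ρ_ m.right).inv ≫ m.right ◁ J.δ₁ ≫ d.homotopy.h ≫ φ.right =
      ((ρ_ m.right).inv ≫ m.right ◁ J.δ₁ ≫ d.homotopy.h) ≫ φ.right := by
    simp only [Category.assoc]
  rw [sdrFill, Category.assoc, ← evalHom_naturality, ← Category.assoc, sdrPathFill_map,
    transpose_evalHom, e, d.homotopy.right, Category.id_comp]

lemma sdrFill_naturality {m' g' : Arrow C} {s' : CoptStr A.comonad m'}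
    {d' : StrongDeformationRetract J m'.hom}
    {t' : AlgStr A.monad ((endpointHom adj J.δ₀).obj g')} {φ' : m' ⟶ g'}
    {α : m ⟶ m'} {β : g ⟶ g'} (hs : s.IsHom s' α) (hd : d.IsHom d' α.right α.left)
    (ht : t.IsHom t' ((endpointHom adj J.δ₀).map β)) (w : φ ≫ β = α ≫ φ') :
    sdrFill adj s d t φ ≫ β.left = α.right ≫ sdrFill adj s' d' t' φ' := by
  rw [sdrFill, sdrFill, Category.assoc, ← evalHom_naturality, ← Category.assoc,
    sdrPathFill_naturality adj s d t φ hs hd ht w, Category.assoc]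

end StrongDeformationRetract

/-! ### Strong deformation retracts with a cofibration structure are trivial cofibrations. -/

section TrivialCofibration

variable {Q : PreAms C}

variable (T : ∀ X : Q.F.Algebra, AlgStr Q.Ft ((endpointHom adj J.δ₀).obj X.A))
  {m : Arrow C} (s : CoptStr Q.Cof m) (d : StrongDeformationRetract J m.hom)

/-- The free `F`-algebra on `m`. -/
def freeFibration (Q : PreAms C) (m : Arrow C) : Q.F.Algebra :=
  let t := freeAlg Q.trivCofFib m
  ⟨Arrow.mk (Q.trivCofFib.rHom m), t.a, t.unit, t.assoc⟩

/-- The square `m ⟶ F m` exhibiting the unit of the monad `F`. -/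
def freeFibrationUnit (Q : PreAms C) (m : Arrow C) :
    m ⟶ Arrow.mk (Q.trivCofFib.rHom m) :=
  Arrow.homMk (Q.trivCofFib.lHom m) (𝟙 _)
    ((Q.trivCofFib.lHom_rHom m).trans (Category.comp_id _).symm)

/-- A strong deformation retract with a cofibration structure is a trivial cofibration. -/
def trivialCofibration : CoptStr Q.Ct m :=
  -- The filler of the unit square is a map from the codomain of `m` to the middle object of its
  -- `(Cᵗ, F)`-factorisation; its two triangles are the two conditions on a copointed coalgebra.
  CoptStr.ofCoact (A := Q.trivCofFib)
    (sdrFill adj s d (T (freeFibration Q m)) (freeFibrationUnit Q m))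
    (hom_sdrFill adj s d (T (freeFibration Q m)) _)
    (sdrFill_hom adj s d (T (freeFibration Q m)) _)

lemma trivialCofibration_isHom
    (hT : ∀ ⦃X Y : Q.F.Algebra⦄ (φ : X ⟶ Y),
      (T X).IsHom (T Y) ((endpointHom adj J.δ₀).map φ.f))
    {m' : Arrow C} {s' : CoptStr Q.Cof m'} {d' : StrongDeformationRetract J m'.hom}
    {α : m ⟶ m'} (hs : s.IsHom s' α) (hd : d.IsHom d' α.right α.left) :
    (trivialCofibration adj T s d).IsHom (trivialCofibration adj T s' d') α := by
  rw [CoptStr.isHom_iff]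
  -- The square `F α` is a morphism of free algebras, so `hT` applies to it.
  let β : freeFibration Q m ⟶ freeFibration Q m' :=
    ⟨Q.trivCofFib.rMap α, freeAlg_isHom Q.trivCofFib α⟩
  exact sdrFill_naturality adj s d (T (freeFibration Q m)) (freeFibrationUnit Q m) hs hd (hT β)
    (Arrow.hom_ext _ _ (Q.trivCofFib.lHom_K_map α)
      ((Category.id_comp _).trans (Category.comp_id _).symm))

end TrivialCofibration

end PathSpace

/-! ### Sections of trivial fibrations as strong deformation retracts. -/

noncomputable section HomotopyFilling

variable {C : Type u} [Category.{v} C] [SemiCartesianMonoidalCategory C]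

lemma whiskerLeft_fst (X : C) {I : C} (d : 𝟙_ C ⟶ I) : X ◁ d ≫ fst X I = (ρ_ X).hom := by
  rw [← cancel_epi (ρ_ X).inv, rightUnitor_inv_whiskerLeft_fst, Iso.inv_hom_id]

variable [HasFiniteColimits C] {J : Interval C}

section

variable (m : Arrow C)

/-- The inclusion `B ⊗ 1 ⟶ B ⊗ (1 + 1) + A ⊗ I` of the initial endpoint. -/
def boundaryZero : m.right ⊗ 𝟙_ C ⟶ ((boundaryProduct J).obj m).left :=
  m.right ◁ coprod.inl ≫ boundaryInl m

/-- The inclusion `B ⊗ 1 ⟶ B ⊗ (1 + 1) + A ⊗ I` of the final endpoint. -/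
def boundaryOne : m.right ⊗ 𝟙_ C ⟶ ((boundaryProduct J).obj m).left :=
  m.right ◁ coprod.inr ≫ boundaryInl m

lemma boundaryZero_ι : boundaryZero m ≫ boundaryι m = m.right ◁ J.δ₀ := by
  rw [boundaryZero, Category.assoc, boundaryInl_ι, whiskerLeft_inl_boundary]

lemma boundaryOne_ι : boundaryOne m ≫ boundaryι m = m.right ◁ J.δ₁ := by
  rw [boundaryOne, Category.assoc, boundaryInl_ι, whiskerLeft_inr_boundary]

lemma boundaryZero_map {m n : Arrow C} (φ : m ⟶ n) :
    boundaryZero m ≫ ((boundaryProduct J).map φ).left = φ.right ▷ _ ≫ boundaryZero n := by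
  rw [boundaryZero, Category.assoc, boundaryInl_map, whisker_exchange_assoc, boundaryZero]

lemma boundaryOne_map {m n : Arrow C} (φ : m ⟶ n) :
    boundaryOne m ≫ ((boundaryProduct J).map φ).left = φ.right ▷ _ ≫ boundaryOne n := by
  rw [boundaryOne, Category.assoc, boundaryInl_map, whisker_exchange_assoc, boundaryOne]

variable {m} in
lemma boundaryProduct_hom_ext' (hcolim : ∀ X : C, PreservesFiniteColimits (tensorLeft X))
    {Z : C} {a b : ((boundaryProduct J).obj m).left ⟶ Z}
    (h₀ : boundaryZero m ≫ a = boundaryZero m ≫ b) (h₁ : boundaryOne m ≫ a = boundaryOne m ≫ b)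
    (h₂ : boundaryInr m ≫ a = boundaryInr m ≫ b) : a = b := by
  rw [boundaryZero, Category.assoc, Category.assoc] at h₀
  rw [boundaryOne, Category.assoc, Category.assoc] at h₁
  exact boundaryProduct_hom_ext hcolim h₀ h₁ h₂

end

variable (hcolim : ∀ X : C, PreservesFiniteColimits (tensorLeft X))
  {m : Arrow C} (f : m.right ⟶ m.left) (hf : m.hom ≫ f = 𝟙 _)

/-- The boundary of a homotopy from `f ≫ s` to the identity, for a section `s` of `f`. -/
def homotopyBoundary : ((boundaryProduct J).obj m).left ⟶ m.right :=
  boundaryDesc m hcolim (f ≫ m.hom) (𝟙 _) (fst m.left J.I ≫ m.hom)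
    (by
      have h := rightUnitor_inv_whiskerLeft_fst m.left J.δ₀
      rw [reassoc_of% h, reassoc_of% hf])
    (by
      have h := rightUnitor_inv_whiskerLeft_fst m.left J.δ₁
      rw [reassoc_of% h, Category.comp_id])

lemma boundaryZero_homotopyBoundary : boundaryZero m ≫ homotopyBoundary (J := J) hcolim f hf =
    (ρ_ m.right).hom ≫ f ≫ m.hom :=
  (Category.assoc _ _ _).trans (whiskerLeft_boundaryInl_desc_zero ..)

lemma boundaryOne_homotopyBoundary : boundaryOne m ≫ homotopyBoundary (J := J) hcolim f hf =
    (ρ_ m.right).hom :=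
  (Category.assoc _ _ _).trans
    ((whiskerLeft_boundaryInl_desc_one ..).trans (Category.comp_id _))

lemma boundaryInr_homotopyBoundary : boundaryInr m ≫ homotopyBoundary (J := J) hcolim f hf =
    fst m.left J.I ≫ m.hom :=
  boundaryInr_desc ..

/-- After `f` the boundary data become the constant homotopy on `f`: at the start because `m` is a
section of `f`, at the end trivially, and on `A ⊗ I` because the data are already constant there.
The homotopy can hence be sought over a constant one. -/
lemma homotopyBoundary_comp :
    homotopyBoundary (J := J) hcolim f hf ≫ f = boundaryι m ≫ fst m.right J.I ≫ f := by
  refine boundaryProduct_hom_ext' hcolim ?_ ?_ ?_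
  · rw [reassoc_of% boundaryZero_homotopyBoundary, reassoc_of% boundaryZero_ι, hf,
      Category.comp_id, reassoc_of% whiskerLeft_fst]
  · rw [reassoc_of% boundaryOne_homotopyBoundary, reassoc_of% boundaryOne_ι,
      reassoc_of% whiskerLeft_fst]
  · rw [reassoc_of% boundaryInr_homotopyBoundary, reassoc_of% boundaryInr_ι,
      reassoc_of% whiskerRight_fst]

/-- The lifting problem from `s □ [δ₀, δ₁]` to `f`, for a section `s` of `f`, whose solutions are
homotopies from `f ≫ s` to the identity. -/
def homotopySquare : (boundaryProduct J).obj m ⟶ Arrow.mk f :=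
  Arrow.homMk (homotopyBoundary hcolim f hf) (fst m.right J.I ≫ f)
    (homotopyBoundary_comp hcolim f hf)

variable {A : Awfs C} (s : CoptStr A.comonad ((boundaryProduct J).obj m))
  (t : AlgStr A.monad (Arrow.mk f))

/-- The homotopy from `f ≫ s` to the identity, for a section `s` of a trivial fibration `f`. -/
def homotopyFill : m.right ⊗ J.I ⟶ m.right := fill s t (homotopySquare hcolim f hf)

lemma boundaryι_homotopyFill :
    boundaryι m ≫ homotopyFill hcolim f hf s t = homotopyBoundary hcolim f hf :=
  hom_fill s t _

/-- A section of a trivial fibration is a strong deformation retract if its pushout product with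
the boundary of the interval is a cofibration. -/
def sdrOfTrivialFibration : StrongDeformationRetract J m.hom where
  f := f
  section_retraction := hf
  homotopy :=
    { h := homotopyFill hcolim f hf s t
      left := by
        rw [← boundaryZero_ι, Category.assoc, boundaryι_homotopyFill,
          boundaryZero_homotopyBoundary, Iso.inv_hom_id_assoc]
      right := by
        rw [← boundaryOne_ι, Category.assoc, boundaryι_homotopyFill,
          boundaryOne_homotopyBoundary, Iso.inv_hom_id] }
  constant := by
    rw [← boundaryInr_ι, Category.assoc, boundaryι_homotopyFill, boundaryInr_homotopyBoundary]

lemma sdrOfTrivialFibration_isHom {m' : Arrow C} {f' : m'.right ⟶ m'.left}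
    {hf' : m'.hom ≫ f' = 𝟙 _} {s' : CoptStr A.comonad ((boundaryProduct J).obj m')}
    {t' : AlgStr A.monad (Arrow.mk f')} (φ : m ⟶ m') (w : φ.right ≫ f' = f ≫ φ.left)
    (hs : s.IsHom s' ((boundaryProduct J).map φ))
    (ht : t.IsHom t' (Arrow.homMk' φ.right φ.left w)) :
    (sdrOfTrivialFibration hcolim f hf s t).IsHom (sdrOfTrivialFibration hcolim f' hf' s' t')
      φ.right φ.left where
  retraction := w.symm
  inclusion := (Arrow.w φ).symm
  homotopy := by
    -- Both homotopies are fillers, so it is enough to compare the two lifting problems, the upper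
    -- side on each piece of the pushout.
    refine (fill_naturality hs ht (Arrow.hom_ext _ _ ?_ ?_)).symm
    · change homotopyBoundary hcolim f hf ≫ φ.right =
        ((boundaryProduct J).map φ).left ≫ homotopyBoundary hcolim f' hf'
      refine boundaryProduct_hom_ext' hcolim ?_ ?_ ?_
      · rw [reassoc_of% boundaryZero_homotopyBoundary, reassoc_of% boundaryZero_map,
          boundaryZero_homotopyBoundary, ← Arrow.w φ, rightUnitor_naturality_assoc,
          reassoc_of% w]
      · rw [reassoc_of% boundaryOne_homotopyBoundary, reassoc_of% boundaryOne_map,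
          boundaryOne_homotopyBoundary, rightUnitor_naturality]
      · rw [reassoc_of% boundaryInr_homotopyBoundary, reassoc_of% boundaryInr_map,
          boundaryInr_homotopyBoundary, ← Arrow.w φ, reassoc_of% whiskerRight_fst]
    · change (fst m.right J.I ≫ f) ≫ φ.left = φ.right ▷ J.I ≫ fst m'.right J.I ≫ f'
      rw [reassoc_of% whiskerRight_fst, w, Category.assoc]

end HomotopyFilling

/-! ### Endpoint maps of the mapping path space as pullbacks of pullback homs. -/

noncomputable section MappingPath

variable {C : Type u} [Category.{v} C] [SemiCartesianMonoidalCategory C] [HasFiniteLimits C]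
  {J : Interval C} {P : C ⥤ C} (adj : tensorRight J.I ⊣ P)

section Endpoint

variable (d : 𝟙_ C ⟶ J.I) (f : Arrow C)

/-- The map along which `proj` is a pullback of the pullback hom with an endpoint. -/
def projRight : f.left ⟶ ((endpointHom adj d).obj f).right :=
  endpointHomLift adj d f (𝟙 _) (f.hom ≫ constHom adj f.right)
    (by rw [Category.id_comp, Category.assoc, constHom_evalHom, Category.comp_id])

lemma projRight_fst : projRight adj d f ≫ endpointHomFst adj d f = 𝟙 _ :=
  endpointHomLift_fst ..

lemma projRight_snd :
    projRight adj d f ≫ endpointHomSnd adj d f = f.hom ≫ constHom adj f.right :=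
  endpointHomLift_snd ..

lemma pathFst_endpointHomHom :
    pathFst adj f ≫ endpointHomHom adj d f = proj adj d f ≫ projRight adj d f := by
  refine endpointHom_hom_ext ?_ ?_
  · rw [Category.assoc, Category.assoc, endpointHomHom_fst, projRight_fst, Category.comp_id]
    rfl
  · rw [Category.assoc, Category.assoc, endpointHomHom_snd, projRight_snd, path_condition,
      ← proj_over adj d, Category.assoc]

/-- A map to the mapping path space from its components. -/
def pathLift {W : C} (a : W ⟶ P.obj f.left) (b : W ⟶ f.right)
    (w : a ≫ P.map f.hom = b ≫ constHom adj f.right) : W ⟶ (mappingPath adj).obj f :=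
  pullback.lift a b w

lemma pathLift_fst {W : C} (a : W ⟶ P.obj f.left) (b : W ⟶ f.right)
    (w : a ≫ P.map f.hom = b ≫ constHom adj f.right) :
    pathLift adj f a b w ≫ pathFst adj f = a := pullback.lift_fst _ _ _

lemma pathLift_snd {W : C} (a : W ⟶ P.obj f.left) (b : W ⟶ f.right)
    (w : a ≫ P.map f.hom = b ≫ constHom adj f.right) :
    pathLift adj f a b w ≫ pathSnd adj f = b := pullback.lift_snd _ _ _

lemma isPullback_path :
    IsPullback (pathFst adj f) (pathSnd adj f) (P.map f.hom) (constHom adj f.right) :=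
  IsPullback.of_hasPullback _ _

/-- In generalised elements, `projRight` sends `x` to `x` with the constant path at `f x`. A path in
`X` over such data is a path lying over a constant path and taking the value `x` at `d`, which is a
point of `P_Y(X)` projecting to `x`. -/
lemma isPullback_proj :
    IsPullback (pathFst adj f) (proj adj d f) (endpointHomHom adj d f) (projRight adj d f) := by
  have key : ∀ {W : C} (a : W ⟶ P.obj f.left) (b : W ⟶ f.left)
      (_ : a ≫ endpointHomHom adj d f = b ≫ projRight adj d f),
      a ≫ evalHom adj d f.left = b ∧ a ≫ P.map f.hom = (b ≫ f.hom) ≫ constHom adj f.right := by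
    intro W a b w
    constructor
    · rw [← endpointHomHom_fst, ← Category.assoc, w, Category.assoc, projRight_fst,
        Category.comp_id]
    · rw [← endpointHomHom_snd adj d, ← Category.assoc, w, Category.assoc, projRight_snd,
        Category.assoc]
  refine ⟨⟨pathFst_endpointHomHom adj d f⟩, ⟨PullbackCone.IsLimit.mk _
    (fun s => pathLift adj f s.fst (s.snd ≫ f.hom) (key _ _ s.condition).2) ?_ ?_ ?_⟩⟩
  · exact fun s => pathLift_fst ..
  · intro s
    rw [proj, ← Category.assoc, pathLift_fst]
    exact (key _ _ s.condition).1
  · intro s m h₁ h₂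
    refine path_hom_ext adj ?_ ?_
    · rw [h₁, pathLift_fst]
    · rw [pathLift_snd, ← h₂, Category.assoc, proj_over]

/-- The square from `proj` to the pullback hom with an endpoint. -/
def projSquare : Arrow.mk (proj adj d f) ⟶ (endpointHom adj d).obj f :=
  Arrow.homMk (pathFst adj f) (projRight adj d f) (pathFst_endpointHomHom adj d f)

/-- The square between projections from mapping path spaces. -/
def projMap {f g : Arrow C} (φ : f ⟶ g) : Arrow.mk (proj adj d f) ⟶ Arrow.mk (proj adj d g) :=
  Arrow.homMk' ((mappingPath adj).map φ) φ.left (proj_naturality adj d φ)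

lemma projSquare_naturality {f g : Arrow C} (φ : f ⟶ g) :
    projSquare adj d f ≫ (endpointHom adj d).map φ = projMap adj d φ ≫ projSquare adj d g := by
  refine Arrow.hom_ext _ _ (map_pathFst adj φ).symm ?_
  change projRight adj d f ≫ ((endpointHom adj d).map φ).right = φ.left ≫ projRight adj d g
  refine endpointHom_hom_ext ?_ ?_
  · rw [Category.assoc, Category.assoc, endpointHom_map_right_fst, projRight_fst,
      reassoc_of% projRight_fst, Category.comp_id]
  · rw [Category.assoc, Category.assoc, endpointHom_map_right_snd, projRight_snd,
      reassoc_of% projRight_snd, ← constHom_naturality, ← Category.assoc, ← Category.assoc,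
      Arrow.w]

end Endpoint

section SelfPullback

omit [SemiCartesianMonoidalCategory C]

variable (f : Arrow C)

/-- The first projection from `X ×_Y X`. -/
def selfFst : (selfPullback C).obj f ⟶ f.left := pullback.fst f.hom f.hom

/-- The second projection from `X ×_Y X`. -/
def selfSnd : (selfPullback C).obj f ⟶ f.left := pullback.snd f.hom f.hom

lemma isPullback_self : IsPullback (selfFst f) (selfSnd f) f.hom f.hom :=
  IsPullback.of_hasPullback _ _

variable {f} in
lemma self_hom_ext {W : C} {a b : W ⟶ (selfPullback C).obj f}
    (h₁ : a ≫ selfFst f = b ≫ selfFst f) (h₂ : a ≫ selfSnd f = b ≫ selfSnd f) : a = b :=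
  pullback.hom_ext h₁ h₂

lemma selfPullback_map_fst {f g : Arrow C} (φ : f ⟶ g) :
    (selfPullback C).map φ ≫ selfFst g = selfFst f ≫ φ.left := pullback.lift_fst _ _ _

lemma selfPullback_map_snd {f g : Arrow C} (φ : f ⟶ g) :
    (selfPullback C).map φ ≫ selfSnd g = selfSnd f ≫ φ.left := pullback.lift_snd _ _ _

/-- The fibre product of `f` with itself is stable under base change of `Y`; pasting and cancelling
pullbacks expresses this over the base. -/
lemma isPullback_selfPullback_map {f g : Arrow C} (φ : f ⟶ g)
    (H : IsPullback φ.left f.hom g.hom φ.right) :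
    IsPullback ((selfPullback C).map φ) (selfFst f ≫ f.hom) (selfFst g ≫ g.hom) φ.right := by
  refine IsPullback.paste_vert ?_ H
  refine IsPullback.of_right ?_ (selfPullback_map_fst φ) (isPullback_self g).flip
  rw [selfPullback_map_snd, Arrow.w]
  exact (isPullback_self f).flip.paste_horiz H

end SelfPullback

section Boundary

variable (f : Arrow C)

lemma projPair_fst : projPair adj f ≫ selfFst f = proj adj J.δ₀ f := pullback.lift_fst _ _ _

lemma projPair_snd : projPair adj f ≫ selfSnd f = proj adj J.δ₁ f := pullback.lift_snd _ _ _

/-- The map along which `projPair` is a pullback of the pullback hom with the boundary. -/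
def projPairRight : (selfPullback C).obj f ⟶ ((boundaryHom adj).obj f).right :=
  boundaryHomLift adj f (selfFst f) (selfSnd f) (selfFst f ≫ f.hom ≫ constHom adj f.right)
    (by simp only [Category.assoc, constHom_evalHom, Category.comp_id])
    (by simp only [Category.assoc, constHom_evalHom, Category.comp_id, (isPullback_self f).w])

lemma projPairRight_fst :
    projPairRight adj f ≫ boundaryHomFst adj f = prod.lift (selfFst f) (selfSnd f) :=
  boundaryHomLift_fst ..

lemma projPairRight_snd :
    projPairRight adj f ≫ boundaryHomSnd adj f = selfFst f ≫ f.hom ≫ constHom adj f.right :=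
  boundaryHomLift_snd ..

lemma pathFst_boundaryHomHom :
    pathFst adj f ≫ boundaryHomHom adj f = projPair adj f ≫ projPairRight adj f := by
  refine boundaryHom_hom_ext ?_ ?_
  · rw [Category.assoc, Category.assoc, boundaryHomHom_fst, projPairRight_fst, prod.comp_lift,
      prod.comp_lift, projPair_fst, projPair_snd]
    rfl
  · rw [Category.assoc, Category.assoc, boundaryHomHom_snd, projPairRight_snd, path_condition,
      reassoc_of% projPair_fst, reassoc_of% proj_over]

/-- As for a single endpoint: the pair `(x₀, x₁)` over `y` is sent to itself with the constant path
at `y`, and a path in `X` over these data is a point of `P_Y(X)` with these endpoints. -/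
lemma isPullback_projPair :
    IsPullback (pathFst adj f) (projPair adj f) (boundaryHomHom adj f)
      (projPairRight adj f) := by
  have key : ∀ {W : C} (a : W ⟶ P.obj f.left) (b : W ⟶ (selfPullback C).obj f)
      (_ : a ≫ boundaryHomHom adj f = b ≫ projPairRight adj f),
      a ≫ evalHom adj J.δ₀ f.left = b ≫ selfFst f ∧
      a ≫ evalHom adj J.δ₁ f.left = b ≫ selfSnd f ∧
      a ≫ P.map f.hom = (b ≫ selfFst f ≫ f.hom) ≫ constHom adj f.right := by
    intro W a b w
    have h : a ≫ prod.lift (evalHom adj J.δ₀ f.left) (evalHom adj J.δ₁ f.left) =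
        b ≫ prod.lift (selfFst f) (selfSnd f) := by
      rw [← boundaryHomHom_fst, ← projPairRight_fst adj, ← Category.assoc, w, Category.assoc]
    refine ⟨?_, ?_, ?_⟩
    · simpa only [Category.assoc, prod.lift_fst] using congrArg (· ≫ Limits.prod.fst) h
    · simpa only [Category.assoc, prod.lift_snd] using congrArg (· ≫ Limits.prod.snd) h
    · rw [← boundaryHomHom_snd adj, ← Category.assoc, w, Category.assoc, projPairRight_snd]
      simp only [Category.assoc]
  refine ⟨⟨pathFst_boundaryHomHom adj f⟩, ⟨PullbackCone.IsLimit.mk _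
    (fun s => pathLift adj f s.fst (s.snd ≫ selfFst f ≫ f.hom) (key _ _ s.condition).2.2)
    ?_ ?_ ?_⟩⟩
  · exact fun s => pathLift_fst ..
  · intro s
    refine self_hom_ext ?_ ?_
    · rw [Category.assoc, projPair_fst, proj, ← Category.assoc, pathLift_fst]
      exact (key _ _ s.condition).1
    · rw [Category.assoc, projPair_snd, proj, ← Category.assoc, pathLift_fst]
      exact (key _ _ s.condition).2.1
  · intro s m h₁ h₂
    refine path_hom_ext adj ?_ ?_
    · rw [h₁, pathLift_fst]
    · rw [pathLift_snd, ← h₂, Category.assoc, reassoc_of% projPair_fst, proj_over]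

/-- The square from `projPair` to the pullback hom with the boundary. -/
def projPairSquare : Arrow.mk (projPair adj f) ⟶ (boundaryHom adj).obj f :=
  Arrow.homMk (pathFst adj f) (projPairRight adj f) (pathFst_boundaryHomHom adj f)

/-- The square between endpoint maps of mapping path spaces. -/
def projPairMap {f g : Arrow C} (φ : f ⟶ g) :
    Arrow.mk (projPair adj f) ⟶ Arrow.mk (projPair adj g) :=
  Arrow.homMk' ((mappingPath adj).map φ) ((selfPullback C).map φ) (projPair_naturality adj φ)

lemma projPairSquare_naturality {f g : Arrow C} (φ : f ⟶ g) :
    projPairSquare adj f ≫ (boundaryHom adj).map φ =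
      projPairMap adj φ ≫ projPairSquare adj g := by
  refine Arrow.hom_ext _ _ (map_pathFst adj φ).symm ?_
  change projPairRight adj f ≫ ((boundaryHom adj).map φ).right =
    (selfPullback C).map φ ≫ projPairRight adj g
  refine boundaryHom_hom_ext ?_ ?_
  · rw [Category.assoc, Category.assoc, boundaryHom_map_right_fst, projPairRight_fst,
      reassoc_of% projPairRight_fst, prod.lift_map, prod.comp_lift, selfPullback_map_fst,
      selfPullback_map_snd]
  · rw [Category.assoc, Category.assoc, boundaryHom_map_right_snd, projPairRight_snd,
      reassoc_of% projPairRight_snd, ← constHom_naturality, reassoc_of% selfPullback_map_fst]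
    exact congrArg (selfFst f ≫ ·) (Arrow.w_assoc φ _).symm

end Boundary

/-! ### Pullback squares between mapping path spaces. -/

section Stability

variable {f g : Arrow C} (φ : f ⟶ g) (H : IsPullback φ.left f.hom g.hom φ.right)

include H

/-- The right adjoint `P` preserves the given pullback. Pasting it with the square defining
`P_Y(X)`, and cancelling the one defining `P_Y'(X')`, leaves the claim. -/
lemma isPullback_mappingPath_map :
    IsPullback ((mappingPath adj).map φ) (pathSnd adj f) (pathSnd adj g) φ.right := by
  have := adj.rightAdjoint_preservesLimits
  refine IsPullback.of_right ?_ (map_pathSnd adj φ) (isPullback_path adj g)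
  rw [map_pathFst, constHom_naturality]
  exact (isPullback_path adj f).paste_horiz (H.map P)

/-- Composing `r` with the projection to `Y` gives back `f`, so the outer rectangle is the given
pullback and the lower square cancels. The result is the input for pullback stability of `(C, Fᵗ)`.
-/
lemma isPullback_reflHom :
    IsPullback φ.left (reflHom adj f) (reflHom adj g) ((mappingPath adj).map φ) := by
  refine IsPullback.of_bot ?_ (reflHom_naturality adj φ) (isPullback_mappingPath_map adj φ H)
  rwa [reflHom_pathSnd, reflHom_pathSnd]

/-- Both `P_Y(X)` and `X ×_Y X` are stable under base change over `Y`, so cancellation gives the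
square between them. -/
lemma isPullback_projPair_map :
    IsPullback ((mappingPath adj).map φ) (projPair adj f) (projPair adj g)
      ((selfPullback C).map φ) := by
  refine IsPullback.of_bot ?_ (projPair_naturality adj φ) (isPullback_selfPullback_map φ H)
  rw [reassoc_of% projPair_fst, reassoc_of% projPair_fst, proj_over, proj_over]
  exact isPullback_mappingPath_map adj φ H

end Stability

end MappingPath

/-! ### The structures on `Id_Y(X)`. -/

noncomputable section IdentityTypes

variable {C : Type u} [Category.{v} C] [SemiCartesianMonoidalCategory C] [HasFiniteLimits C]
  {J : Interval C} {P : C ⥤ C} (adj : tensorRight J.I ⊣ P) {Q : PreAms C}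

section TrivialFibration

variable (T : ∀ X : Q.F.Algebra, AlgStr Q.Ft ((endpointHom adj J.δ₀).obj X.A))

/-- The trivial fibration structure on `P_Y(X) ⟶ X`. -/
def projAlg (X : Q.F.Algebra) : AlgStr Q.Ft (Arrow.mk (proj adj J.δ₀ X.A)) :=
  AlgStr.pullback (A := Q.cofTrivFib) (T X) (projSquare adj J.δ₀ X.A)
    (isPullback_proj adj J.δ₀ X.A)

/-- The retraction `Id_Y(X) ⟶ X`. -/
def idRetraction (Q : PreAms C) (f : Arrow C) :
    Q.cofTrivFib.K.obj ((reflArrow adj).obj f) ⟶ f.left :=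
  Q.cofTrivFib.rHom ((reflArrow adj).obj f) ≫ proj adj J.δ₀ f

lemma lHom_idRetraction (f : Arrow C) :
    Q.cofTrivFib.lHom ((reflArrow adj).obj f) ≫ idRetraction adj Q f = 𝟙 _ :=
  (Category.assoc _ _ _).symm.trans
    ((congrArg (· ≫ proj adj J.δ₀ f) (Q.cofTrivFib.lHom_rHom _)).trans
      (reflHom_proj adj J.δ₀ f))

lemma idRetraction_naturality {f g : Arrow C} (φ : f ⟶ g) :
    Q.cofTrivFib.K.map ((reflArrow adj).map φ) ≫ idRetraction adj Q g =
      idRetraction adj Q f ≫ φ.left :=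
  (Category.assoc _ _ _).symm.trans
    ((congrArg (· ≫ proj adj J.δ₀ g)
      (Q.cofTrivFib.K_map_rHom ((reflArrow adj).map φ))).trans
    ((Category.assoc _ _ _).trans
    ((congrArg (Q.cofTrivFib.rHom ((reflArrow adj).obj f) ≫ ·)
      (proj_naturality adj J.δ₀ φ)).trans (Category.assoc _ _ _).symm)))

/-- The trivial fibration structure on the retraction `Id_Y(X) ⟶ X`. -/
def idRetractionAlg (X : Q.F.Algebra) : AlgStr Q.Ft (Arrow.mk (idRetraction adj Q X.A)) :=
  AlgStr.comp (A := Q.cofTrivFib) (freeAlg Q.cofTrivFib ((reflArrow adj).obj X.A))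
    (projAlg adj T X)

variable (hT : ∀ ⦃X Y : Q.F.Algebra⦄ (φ : X ⟶ Y),
  (T X).IsHom (T Y) ((endpointHom adj J.δ₀).map φ.f))
include hT

lemma projAlg_isHom {X Y : Q.F.Algebra} (φ : X ⟶ Y) :
    (projAlg adj T X).IsHom (projAlg adj T Y) (projMap adj J.δ₀ φ.f) :=
  AlgStr.pullback_map_isHom (A := Q.cofTrivFib) _ _ _ _ _ _ (hT φ)
    (projSquare_naturality adj J.δ₀ φ.f)

lemma idRetractionAlg_isHom {X Y : Q.F.Algebra} (φ : X ⟶ Y) :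
    (idRetractionAlg adj T X).IsHom (idRetractionAlg adj T Y)
      (Arrow.homMk' (Q.cofTrivFib.K.map ((reflArrow adj).map φ.f)) φ.f.left
        (idRetraction_naturality adj φ.f)) :=
  AlgStr.comp_isHom (A := Q.cofTrivFib)
    (freeAlg_isHom Q.cofTrivFib ((reflArrow adj).map φ.f)) (projAlg_isHom adj T hT φ)
    rfl rfl rfl

end TrivialFibration

section Fibration

variable (T : ∀ X : Q.F.Algebra, AlgStr Q.F ((boundaryHom adj).obj X.A))

/-- The fibration structure on `P_Y(X) ⟶ X ×_Y X`. -/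
def projPairAlg (X : Q.F.Algebra) : AlgStr Q.F (Arrow.mk (projPair adj X.A)) :=
  AlgStr.pullback (A := Q.trivCofFib) (T X) (projPairSquare adj X.A)
    (isPullback_projPair adj X.A)

/-- The fibration structure on `Id_Y(X) ⟶ X ×_Y X`. -/
def idFibration (X : Q.F.Algebra) :
    AlgStr Q.F (Arrow.mk ((idFactorisation adj Q).p.app X)) :=
  AlgStr.comp (A := Q.trivCofFib)
    -- The free structure belongs to `Fᵗ`; the comparison `ξ` makes it an `F`-structure, composable
    -- with that of `p_f`.
    (AlgStr.restrict Q.comparison (freeAlg Q.cofTrivFib ((reflArrow adj).obj X.A)))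
    (projPairAlg adj T X)

variable (hT : ∀ ⦃X Y : Q.F.Algebra⦄ (φ : X ⟶ Y),
  (T X).IsHom (T Y) ((boundaryHom adj).map φ.f))
include hT

lemma projPairAlg_isHom {X Y : Q.F.Algebra} (φ : X ⟶ Y) :
    (projPairAlg adj T X).IsHom (projPairAlg adj T Y) (projPairMap adj φ.f) :=
  AlgStr.pullback_map_isHom (A := Q.trivCofFib) _ _ _ _ _ _ (hT φ)
    (projPairSquare_naturality adj φ.f)

lemma idFibration_isHom {X Y : Q.F.Algebra} (φ : X ⟶ Y) :
    (idFibration adj T X).IsHom (idFibration adj T Y) ((idFactorisation adj Q).pSquare φ) :=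
  AlgStr.comp_isHom (A := Q.trivCofFib)
    (AlgStr.restrict_isHom Q.comparison
      (freeAlg_isHom Q.cofTrivFib ((reflArrow adj).map φ.f)))
    (projPairAlg_isHom adj T hT φ) rfl rfl rfl

end Fibration

/-- Two pullbacks are pasted: the square `Fᵗ r ⟶ Fᵗ r'`, by pullback stability, and the square of
endpoint maps. -/
lemma idFactorisation_stable (hstable : Q.cofTrivFib.PullbackStable) {X Y : Q.F.Algebra}
    (φ : X ⟶ Y) (H : IsPullback φ.f.left X.A.hom Y.A.hom φ.f.right) :
    IsPullback ((idFactorisation adj Q).P.map φ) ((idFactorisation adj Q).p.app X)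
      ((idFactorisation adj Q).p.app Y) ((selfPullback C).map φ.f) :=
  (hstable ((reflArrow adj).map φ.f) (isPullback_reflHom adj φ.f H)).paste_vert
    (isPullback_projPair_map adj φ.f H)

variable [HasFiniteColimits C] (hcolim : ∀ X : C, PreservesFiniteColimits (tensorLeft X))
  (S : ∀ m : Arrow C, CoptStr Q.Cof m → CoptStr Q.Cof ((boundaryProduct J).obj m))
  (T : ∀ X : Q.F.Algebra, AlgStr Q.Ft ((endpointHom adj J.δ₀).obj X.A))

/-- The strong deformation retract given by `X ⟶ Id_Y(X)`. -/
def idRetract (X : Q.F.Algebra) :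
    StrongDeformationRetract J ((idFactorisation adj Q).r.app X) :=
  sdrOfTrivialFibration (A := Q.cofTrivFib)
    (m := Arrow.mk (Q.cofTrivFib.lHom ((reflArrow adj).obj X.A))) hcolim
    (idRetraction adj Q X.A) (lHom_idRetraction adj X.A)
    (S _ (cofreeCopt Q.cofTrivFib ((reflArrow adj).obj X.A))) (idRetractionAlg adj T X)

/-- The trivial cofibration structure on `X ⟶ Id_Y(X)`. -/
def idTrivialCofibration (X : Q.F.Algebra) :
    CoptStr Q.Ct (Arrow.mk ((idFactorisation adj Q).r.app X)) :=
  trivialCofibration adj T (cofreeCopt Q.cofTrivFib ((reflArrow adj).obj X.A))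
    (idRetract adj hcolim S T X)

variable (hS : ∀ ⦃m n : Arrow C⦄ (a : CoptStr Q.Cof m) (b : CoptStr Q.Cof n) (φ : m ⟶ n),
    a.IsHom b φ → (S m a).IsHom (S n b) ((boundaryProduct J).map φ))
  (hT : ∀ ⦃X Y : Q.F.Algebra⦄ (φ : X ⟶ Y),
    (T X).IsHom (T Y) ((endpointHom adj J.δ₀).map φ.f))
include hS hT

lemma idRetract_isHom {X Y : Q.F.Algebra} (φ : X ⟶ Y) :
    (idRetract adj hcolim S T X).IsHom (idRetract adj hcolim S T Y)
      ((idFactorisation adj Q).P.map φ) φ.f.left :=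
  sdrOfTrivialFibration_isHom (A := Q.cofTrivFib) hcolim _ _ _ _
    (Q.cofTrivFib.lMap ((reflArrow adj).map φ.f)) (idRetraction_naturality adj φ.f)
    (hS _ _ _ (cofreeCopt_isHom Q.cofTrivFib _)) (idRetractionAlg_isHom adj T hT φ)

lemma idTrivialCofibration_isHom {X Y : Q.F.Algebra} (φ : X ⟶ Y) :
    (idTrivialCofibration adj hcolim S T X).IsHom (idTrivialCofibration adj hcolim S T Y)
      ((idFactorisation adj Q).rSquare φ) :=
  trivialCofibration_isHom adj T _ _ hT
    (cofreeCopt_isHom Q.cofTrivFib ((reflArrow adj).map φ.f))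
    (idRetract_isHom adj hcolim S T hS hT φ)

end IdentityTypes

end AlgModel

theorem mainTheorem1 {C : Type u} [Category.{v} C] [SemiCartesianMonoidalCategory C]
    [SymmetricCategory C] [HasFiniteLimits C] [HasFiniteColimits C]
    (hcolim : ∀ X : C, PreservesFiniteColimits (tensorLeft X))
    (J : AlgModel.Interval C) (P : C ⥤ C) (adj : tensorRight J.I ⊣ P)
    (Q : AlgModel.PreAms C) (hstable : Q.cofTrivFib.PullbackStable)
    (axiom₁ : AlgModel.LiftsToCoalgebras Q.Cof Q.Cof
      (Arrow.pushoutProduct.flip.obj (Arrow.mk J.boundary)))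
    (axiom₂_zero : AlgModel.LiftsToAlgebras Q.F Q.Ft (AlgModel.endpointHom adj J.δ₀))
    (axiom₂_one : AlgModel.LiftsToAlgebras Q.F Q.Ft (AlgModel.endpointHom adj J.δ₁))
    (axiom₃ : AlgModel.LiftsToAlgebras Q.F Q.F (AlgModel.boundaryHom adj)) :
    (∃ S : AlgModel.StableFunctorialChoice Q.trivCofFib,
      S.toDiagonalFactorisation = AlgModel.idFactorisation adj Q) ∧
    (∃ d : ∀ f : Q.F.Algebra,
        AlgModel.StrongDeformationRetract J ((AlgModel.idFactorisation adj Q).r.app f),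
      ∀ ⦃f g : Q.F.Algebra⦄ (φ : f ⟶ g),
        (d f).IsHom (d g) ((AlgModel.idFactorisation adj Q).P.map φ) φ.f.left) := by
  obtain ⟨S, hS⟩ := axiom₁
  obtain ⟨T, hT⟩ := axiom₂_zero
  obtain ⟨T', hT'⟩ := axiom₃
  -- The structures are put on the given factorisation itself, so the required equality of
  -- factorisations is definitional.
  refine ⟨⟨{ AlgModel.idFactorisation adj Q with
    rStr := AlgModel.idTrivialCofibration adj hcolim S T
    rStr_hom := fun _ _ φ => AlgModel.idTrivialCofibration_isHom adj hcolim S T hS hT φ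
    pStr := AlgModel.idFibration adj T'
    pStr_hom := fun _ _ φ => AlgModel.idFibration_isHom adj T' hT' φ
    stable := fun _ _ φ H => AlgModel.idFactorisation_stable adj hstable φ H }, rfl⟩,
    AlgModel.idRetract adj hcolim S T,
    fun _ _ φ => AlgModel.idRetract_isHom adj hcolim S T hS hT φ⟩
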